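/- Let $\mathbb K=\mathbb R$ or $\mathbb C$. For $p\in[1,\infty)$ put $X_p=\ell_p$ (scalar sequences over $\mathbb K$), and put $X_\infty=c_0$ with the supremum norm; $e_j$ denotes the $j$-th canonical vector. Use the conventions $1/0=\infty$ and $1/\infty=0$, let $p^*\in[1,\infty]$ be the conjugate exponent, $1/p+1/p^*=1$, and read $\left(\sum_j a_j^{q}\right)^{1/q}$ as $\sup_j a_j$ when $q=\infty$. For $s_k,\dots,s_m\in[1,\infty]$ put $$\delta^{s_k,\dots,s_m}=\frac{1}{\max\left\{1-\left(\frac1{s_k}+\cdots+\frac1{s_m}\right),0\right\}}\in[1,\infty].$$ Let $m\ge 2$ be an integer, let $\sigma$ be a permutation of $\{1,\dots,m\}$, and let $(q_1,\dots,q_{m-1})\in(0,\infty]^{m-1}$ and $(p_1,\dots,p_m)\in[1,\infty]^m$. Then the following assertions are equivalent. (1) There is a constant $C\ge 1$ such that $$\left(\sum_{j_{\sigma(1)}=1}^\infty\left(\sum_{j_{\sigma(2)}=1}^\infty\cdots\left(\sum_{j_{\sigma(m)}=1}^\infty\left|A(e_{j_1},\dots,e_{j_m})\right|^{p_{\sigma(m)}^*}\right)^{\frac{q_{m-1}}{p_{\sigma(m)}^*}}\cdots\right)^{\frac{q_1}{q_2}}\right)^{\frac1{q_1}}\le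 C\,\|A\|$$ for all continuous $m$-linear forms $A:X_{p_1}\times\cdots\times X_{p_m}\to\mathbb K$, where $\|A\|$ is the supremum of $|A(x_1,\dots,x_m)|$ over all $x_i$ in the closed unit ball of $X_{p_i}$. (2) With $\mu=\min\{p_{\sigma(m)},2\}$, $$q_k\ge\delta^{p_{\sigma(k)},\dots,p_{\sigma(m-1)},\mu}\qquad\text{for every } k=1,\dots,m-1.$$ -/

import Mathlib

open Filter Topology
open scoped ENNReal

noncomputable section

/-- The sequence space `X_p` over `𝕜`: all of `ℓ_p` if `p ∈ [1, ∞)` (the condition is then vacuous),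
and `c₀`, with the supremum norm inherited from `ℓ_∞`, if `p = ∞`. -/
def seqSpace (𝕜 : Type*) [RCLike 𝕜] (p : ℝ≥0∞) [Fact (1 ≤ p)] :
    Submodule 𝕜 (lp (fun _ : ℕ => 𝕜) p) where
  carrier := {x | p = ∞ → Tendsto (fun j => x j) atTop (𝓝 0)}
  zero_mem' := fun _ => by simp
  add_mem' := fun {x y} hx hy h => by simpa using (hx h).add (hy h)
  smul_mem' := fun c x hx h => by simpa using (hx h).const_mul c

/-- The canonical vector `e_j` of `X_p`. -/
def seqSpace.e (𝕜 : Type*) [RCLike 𝕜] (p : ℝ≥0∞) [Fact (1 ≤ p)] (j : ℕ) : seqSpace 𝕜 p :=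
  ⟨lp.single p j (1 : 𝕜), fun _ => by
    refine tendsto_const_nhds.congr' ?_
    filter_upwards [eventually_gt_atTop j] with i hi
    simp [hi.ne']⟩

/-- `(∑_j f_j ^ q) ^ (1/q)` in `[0, ∞]`, meaning `sup_j f_j` when `q = ∞` (used for `q > 0`). -/
def lqNorm (q : ℝ≥0∞) (f : ℕ → ℝ≥0∞) : ℝ≥0∞ :=
  if q = ∞ then ⨆ j, f j else (∑' j, f j ^ q.toReal) ^ (1 / q.toReal)

/-- The nested expression
`(∑_{j₀} (∑_{j₁} ⋯ (∑_{j_{k-1}} f(j₀,…,j_{k-1}) ^ s_{k-1}) ^ (s_{k-2}/s_{k-1}) ⋯) ^ (s₀/s₁)) ^ (1/s₀)`,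
the leftmost index being summed outermost. -/
def mixedNorm : (k : ℕ) → (Fin k → ℝ≥0∞) → ((Fin k → ℕ) → ℝ≥0∞) → ℝ≥0∞
  | 0, _, f => f Fin.elim0
  | k + 1, s, f =>
      lqNorm (s 0) fun j => mixedNorm k (fun i => s i.succ) fun js => f (Fin.cons j js)

/-- `δ^{s_k,…,s_{n-1}} = 1 / max {1 - (1/s_k + ⋯ + 1/s_{n-1}), 0}` with `1/0 = ∞`, `1/∞ = 0`;
subtraction in `[0, ∞]` is truncated at `0`. -/
def delta {n : ℕ} (s : Fin n → ℝ≥0∞) (k : Fin n) : ℝ≥0∞ :=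
  (1 - ∑ i ∈ Finset.Ici k, (s i)⁻¹)⁻¹

end

/-! Sufficiency is an induction on the number of variables, based on cotype. After reindexing, `σ`
is the identity. Freezing the first argument turns a form into an operator `T` from `X_{p_1}` into
the coefficient arrays in the remaining variables, normed by the mixed norm with the smallest
admissible exponents (`optExp`). This array space has finite cotype `d`, the `δ` of the remaining
exponents, whenever that `δ` is finite: the innermost `ℓ_{p^*}` has cotype `max(p^*, 2)`, which is
why `min(p, 2)` appears, and every further layer `ℓ_δ` has an exponent at least as large as the
cotype of what it contains (`exists_hasCotype_arrayNorm`). Signs do not change the norm of `∑ w_j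
e_j` in `X_p`, so cotype shows that `w ↦ (w_j ‖T e_j‖)` maps `X_p` into `ℓ_d`. The converse of
Hölder's inequality then puts `‖T e_j‖` in `ℓ_D` with `1/D = 1/d - 1/p` (`lqNorm_le_of_hasCotype`),
which is exactly the recursion for `δ` (`inv_delta_zero`). If `D = ∞`, boundedness of `T` suffices.
Larger exponents only decrease the mixed norm.

Necessity uses one form for each `k`: the variables before `k` enter through coordinate `0`, those
from `k` on share an index `j < N`, and the last is coupled to `j` by a matrix `u` (`testForm`). The
matrix is the identity if the last exponent is at most `2`, and a Hadamard matrix otherwise. Its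
rows have `ℓ_{r^*}` norm at least `L`, while it maps `X_r` to `ℓ_{min(r,2)}` with norm at most `L`.
Hölder's inequality bounds the form by `L N^{1/δ}`, the mixed norm is at least `L N^{1/q_k}`, and `N
= 2 ^ a → ∞` gives `q_k ≥ δ`. -/

open Filter Topology
open scoped ENNReal

/-! ### Sign averages. -/

section Signs

variable {E F : Type*} [AddCommGroup E] [AddCommGroup F]

/-- The signed sum `∑ ± x_j`, with the sign `+` where `ε j` is true. -/
def radSum {J : ℕ} (ε : Fin J → Bool) (x : Fin J → E) : E :=
  ∑ j, bif ε j then x j else -x j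

/-- The average over all choices of signs. -/
noncomputable def signAvg {J : ℕ} (g : (Fin J → Bool) → ℝ≥0∞) : ℝ≥0∞ :=
  ∑ ε, ((2 : ℝ≥0∞) ^ J)⁻¹ * g ε

lemma map_radSum (L : E →+ F) {J : ℕ} (ε : Fin J → Bool) (x : Fin J → E) :
    L (radSum ε x) = radSum ε (fun j => L (x j)) := by
  unfold radSum
  rw [map_sum]
  refine Finset.sum_congr rfl fun j _ => ?_
  cases ε j <;> simp

lemma radSum_cons {J : ℕ} (b : Bool) (ε : Fin J → Bool) (x : Fin (J + 1) → E) :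
    radSum (Fin.cons b ε) x = (bif b then x 0 else -x 0) + radSum ε (fun j => x j.succ) := by
  simp [radSum, Fin.sum_univ_succ]

lemma sum_signs_succ {M : Type*} [AddCommMonoid M] {J : ℕ} (g : (Fin (J + 1) → Bool) → M) :
    ∑ ε, g ε = ∑ ε : Fin J → Bool, (g (Fin.cons true ε) + g (Fin.cons false ε)) := by
  rw [← (Fin.consEquiv (fun _ : Fin (J + 1) => Bool)).sum_comp, Fintype.sum_prod_type,
    Fintype.sum_bool, Finset.sum_add_distrib]
  rfl

lemma sum_sign_weights (J : ℕ) : ∑ _ε : Fin J → Bool, ((2 : ℝ≥0∞) ^ J)⁻¹ = 1 := by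
  simp only [Finset.sum_const, Finset.card_univ, Fintype.card_pi, Fintype.card_bool,
    Finset.prod_const, Fintype.card_fin, nsmul_eq_mul, Nat.cast_pow, Nat.cast_ofNat]
  exact ENNReal.mul_inv_cancel (by simp) (by simp)

lemma signAvg_rpow_le {J : ℕ} (g : (Fin J → Bool) → ℝ≥0∞) {a : ℝ} (ha : 1 ≤ a) :
    (signAvg g) ^ a ≤ signAvg (fun ε => g ε ^ a) :=
  ENNReal.rpow_arith_mean_le_arith_mean_rpow _ _ _ (sum_sign_weights J) ha

lemma signAvg_le {J : ℕ} {g : (Fin J → Bool) → ℝ≥0∞} {M : ℝ≥0∞} (h : ∀ ε, g ε ≤ M) :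
    signAvg g ≤ M := by
  calc signAvg g ≤ ∑ _ε : Fin J → Bool, ((2 : ℝ≥0∞) ^ J)⁻¹ * M :=
        Finset.sum_le_sum fun ε _ => mul_le_mul_right (h ε) _
    _ = M := by rw [← Finset.sum_mul, sum_sign_weights, one_mul]

lemma tsum_signAvg {J : ℕ} (g : ℕ → (Fin J → Bool) → ℝ≥0∞) :
    ∑' l, signAvg (g l) = signAvg (fun ε => ∑' l, g l ε) := by
  unfold signAvg
  rw [Summable.tsum_finsetSum fun _ _ => ENNReal.summable]
  simp_rw [ENNReal.tsum_mul_left]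

lemma signAvg_ofReal {J : ℕ} {g : (Fin J → Bool) → ℝ} (hg : ∀ ε, 0 ≤ g ε) :
    signAvg (fun ε => ENNReal.ofReal (g ε)) = ENNReal.ofReal ((∑ ε, g ε) / 2 ^ J) := by
  unfold signAvg
  rw [← Finset.mul_sum, ← ENNReal.ofReal_sum_of_nonneg fun ε _ => hg ε,
    div_eq_inv_mul, ENNReal.ofReal_mul (by positivity), ENNReal.ofReal_inv_of_pos (by positivity),
    ENNReal.ofReal_pow (by norm_num)]
  simp

end Signs

/-! ### Khintchine's inequality from second and fourth moments. -/

section Khintchine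

variable {𝕜 : Type*} [RCLike 𝕜]

lemma norm_add_sq_add_norm_sub_sq (x f : 𝕜) :
    ‖x + f‖ ^ 2 + ‖-x + f‖ ^ 2 = 2 * (‖x‖ ^ 2 + ‖f‖ ^ 2) := by
  have h := parallelogram_law_with_norm 𝕜 f x
  rw [add_comm x f, neg_add_eq_sub]
  nlinarith [h]

lemma norm_add_pow_four_add_norm_sub_pow_four_le (x f : 𝕜) :
    ‖x + f‖ ^ 4 + ‖-x + f‖ ^ 4 ≤
      2 * (‖x‖ ^ 4 + 6 * (‖x‖ ^ 2 * ‖f‖ ^ 2) + ‖f‖ ^ 4) := by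
  have h1 := norm_add_sq (𝕜 := 𝕜) f x
  have h2 := norm_sub_sq (𝕜 := 𝕜) f x
  rw [add_comm x f, neg_add_eq_sub]
  set r := RCLike.re (inner 𝕜 f x)
  have hr : r ^ 2 ≤ (‖f‖ * ‖x‖) ^ 2 := by
    refine sq_le_sq.2 ?_
    rw [abs_of_nonneg (by positivity : 0 ≤ ‖f‖ * ‖x‖)]
    exact (RCLike.abs_re_le_norm _).trans (norm_inner_le_norm f x)
  have h3 : ‖f + x‖ ^ 4 = (‖f + x‖ ^ 2) ^ 2 := by ring
  have h4 : ‖f - x‖ ^ 4 = (‖f - x‖ ^ 2) ^ 2 := by ring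
  rw [h3, h4, h1, h2]
  nlinarith

lemma sum_norm_radSum_sq {J : ℕ} (x : Fin J → 𝕜) :
    ∑ ε, ‖radSum ε x‖ ^ 2 = 2 ^ J * ∑ j, ‖x j‖ ^ 2 := by
  induction J with
  | zero => simp [radSum]
  | succ J ih =>
    rw [sum_signs_succ, Fin.sum_univ_succ]
    simp only [radSum_cons, cond_true, cond_false, norm_add_sq_add_norm_sub_sq]
    rw [← Finset.mul_sum, Finset.sum_add_distrib, ih]
    simp
    ring

/-- Induction on `J`: the cross term `6 ‖x 0‖² S` of the two-point inequality is exactly the one in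
`3 (‖x 0‖² + S)²`. -/
lemma sum_norm_radSum_pow_four_le {J : ℕ} (x : Fin J → 𝕜) :
    ∑ ε, ‖radSum ε x‖ ^ 4 ≤ 2 ^ J * (3 * (∑ j, ‖x j‖ ^ 2) ^ 2) := by
  induction J with
  | zero => simp [radSum]
  | succ J ih =>
    rw [sum_signs_succ, Fin.sum_univ_succ]
    simp only [radSum_cons, cond_true, cond_false]
    refine (Finset.sum_le_sum fun ε _ =>
      norm_add_pow_four_add_norm_sub_pow_four_le _ _).trans ?_
    rw [← Finset.mul_sum, Finset.sum_add_distrib, Finset.sum_add_distrib, ← Finset.mul_sum,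
      ← Finset.mul_sum, sum_norm_radSum_sq]
    have h := ih (fun j => x j.succ)
    simp only [Finset.sum_const, Finset.card_univ, Fintype.card_pi, Fintype.card_bool,
      Finset.prod_const, Fintype.card_fin, nsmul_eq_mul, Nat.cast_pow, Nat.cast_ofNat]
    have h2 : (0 : ℝ) < 2 ^ J := by positivity
    set S := ∑ j : Fin J, ‖x j.succ‖ ^ 2
    have h3 : 0 ≤ 2 ^ J * ‖x 0‖ ^ 4 := by positivity
    rw [pow_succ (2 : ℝ) J]
    nlinarith

/-- Khintchine's inequality for the first moment. -/
lemma sqrt_sum_sq_le_sum_norm_radSum {J : ℕ} (x : Fin J → 𝕜) :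
    √(∑ j, ‖x j‖ ^ 2) ≤ 2 * ((∑ ε, ‖radSum ε x‖) / 2 ^ J) := by
  set S := ∑ j, ‖x j‖ ^ 2 with hS
  have hS0 : 0 ≤ S := Finset.sum_nonneg fun _ _ => by positivity
  rcases hS0.eq_or_lt with h0 | hpos
  · rw [← h0, Real.sqrt_zero]; positivity
  set s := √S with hs
  have hs0 : 0 < s := Real.sqrt_pos.2 hpos
  have hs2 : s ^ 2 = S := Real.sq_sqrt hS0
  -- This is `f (4f³ - 27 f s² + 27 s³) ≥ 0`, whose cubic has a double root at `f = 3s/2`. Averaging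
  -- it with second moment `s²` and fourth moment at most `3 s⁴` gives `15 s ≤ 27 E‖f‖`, hence the
  -- constant `2`.
  have key : ∀ f : ℝ, 0 ≤ f → f ^ 2 * (27 * s ^ 2) ≤ 27 * s ^ 3 * f + 4 * f ^ 4 := by
    intro f hf
    have : 0 ≤ f * ((2 * f - 3 * s) ^ 2 * (f + 3 * s)) := by positivity
    nlinarith
  have hsum : (∑ ε, ‖radSum ε x‖ ^ 2) * (27 * s ^ 2) ≤
      27 * s ^ 3 * (∑ ε, ‖radSum ε x‖) + 4 * ∑ ε, ‖radSum ε x‖ ^ 4 := by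
    rw [Finset.sum_mul, Finset.mul_sum, Finset.mul_sum, ← Finset.sum_add_distrib]
    exact Finset.sum_le_sum fun ε _ => key _ (norm_nonneg _)
  rw [sum_norm_radSum_sq] at hsum
  have h4 := sum_norm_radSum_pow_four_le x
  rw [← hS, ← hs2] at hsum h4
  have h2 : (0 : ℝ) < 2 ^ J := by positivity
  rw [← mul_div_assoc, le_div_iff₀ h2]
  set T := ∑ ε, ‖radSum ε x‖
  have h5 : s ^ 3 * (15 * s * 2 ^ J) ≤ s ^ 3 * (27 * T) := by nlinarith
  have h6 := le_of_mul_le_mul_left h5 (by positivity)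
  have hT : 0 ≤ s * 2 ^ J := by positivity
  nlinarith

end Khintchine

/-! ### Monotonicity of `ℓ_q` and mixed norms; Minkowski's inequality. -/

section LqNorm

lemma lqNorm_top (f : ℕ → ℝ≥0∞) : lqNorm ∞ f = ⨆ j, f j := by simp [lqNorm]

lemma lqNorm_of_ne_top {q : ℝ≥0∞} (hq : q ≠ ∞) (f : ℕ → ℝ≥0∞) :
    lqNorm q f = (∑' j, f j ^ q.toReal) ^ (1 / q.toReal) := by simp [lqNorm, hq]

lemma lqNorm_rpow {q : ℝ≥0∞} (hq0 : q ≠ 0) (hq : q ≠ ∞) (f : ℕ → ℝ≥0∞) :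
    lqNorm q f ^ q.toReal = ∑' j, f j ^ q.toReal := by
  rw [lqNorm_of_ne_top hq, ← ENNReal.rpow_mul, one_div,
    inv_mul_cancel₀ (ENNReal.toReal_pos hq0 hq).ne', ENNReal.rpow_one]

lemma lqNorm_mono {q : ℝ≥0∞} {f g : ℕ → ℝ≥0∞} (h : ∀ j, f j ≤ g j) :
    lqNorm q f ≤ lqNorm q g := by
  unfold lqNorm
  split_ifs
  · exact iSup_mono h
  · gcongr with j
    exact h j

lemma le_tsum_rpow {ι : Type*} {q : ℝ} (hq : 0 < q) (f : ι → ℝ≥0∞) (j : ι) :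
    f j ≤ (∑' j, f j ^ q) ^ (1 / q) := by
  rw [one_div, ENNReal.le_rpow_inv_iff hq]
  exact ENNReal.le_tsum (f := fun j => f j ^ q) j

lemma le_lqNorm {q : ℝ≥0∞} (hq : q ≠ 0) (f : ℕ → ℝ≥0∞) (j : ℕ) : f j ≤ lqNorm q f := by
  by_cases h : q = ∞
  · rw [h, lqNorm_top]; exact le_iSup f j
  · rw [lqNorm_of_ne_top h]
    exact le_tsum_rpow (ENNReal.toReal_pos hq h) f j

lemma tsum_rpow_le_tsum_rpow {ι : Type*} {q r : ℝ} (hq : 0 < q) (hqr : q ≤ r) (f : ι → ℝ≥0∞) :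
    ∑' j, f j ^ r ≤ (∑' j, f j ^ q) ^ (r / q) := by
  set S := (∑' j, f j ^ q) with hS
  have h1 : ∀ j, f j ^ r ≤ f j ^ q * S ^ ((r - q) / q) := by
    intro j
    calc f j ^ r = f j ^ (q + (r - q)) := by ring_nf
      _ = f j ^ q * f j ^ (r - q) :=
          ENNReal.rpow_add_of_nonneg _ _ hq.le (sub_nonneg.2 hqr)
      _ ≤ f j ^ q * (S ^ (1 / q)) ^ (r - q) := by
          gcongr
          exact le_tsum_rpow hq f j
      _ = _ := by rw [← ENNReal.rpow_mul]; ring_nf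
  calc ∑' j, f j ^ r ≤ ∑' j, f j ^ q * S ^ ((r - q) / q) := ENNReal.tsum_le_tsum h1
    _ = S ^ (1 : ℝ) * S ^ ((r - q) / q) := by rw [ENNReal.tsum_mul_right, ENNReal.rpow_one]
    _ = S ^ (r / q) := by
      rw [← ENNReal.rpow_add_of_nonneg _ _ zero_le_one
        (div_nonneg (sub_nonneg.2 hqr) hq.le)]
      congr 1
      field_simp
      ring

lemma lqNorm_antitone {q r : ℝ≥0∞} (hq : q ≠ 0) (hqr : q ≤ r) (f : ℕ → ℝ≥0∞) :
    lqNorm r f ≤ lqNorm q f := by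
  by_cases hr : r = ∞
  · rw [hr, lqNorm_top]
    exact iSup_le fun j => le_lqNorm hq f j
  have hq' : q ≠ ∞ := ne_top_of_le_ne_top hr hqr
  have hq0 := ENNReal.toReal_pos hq hq'
  have hqr' : q.toReal ≤ r.toReal := ENNReal.toReal_mono hr hqr
  have hr0 := hq0.trans_le hqr'
  rw [lqNorm_of_ne_top hr, lqNorm_of_ne_top hq', one_div, ENNReal.rpow_inv_le_iff hr0,
    ← ENNReal.rpow_mul]
  convert tsum_rpow_le_tsum_rpow hq0 hqr' f using 2
  ring

lemma mixedNorm_succ {k : ℕ} (s : Fin (k + 1) → ℝ≥0∞) (f : (Fin (k + 1) → ℕ) → ℝ≥0∞) :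
    mixedNorm (k + 1) s f = lqNorm (s 0) fun j =>
      mixedNorm k (fun i => s i.succ) fun js => f (Fin.cons j js) := rfl

lemma mixedNorm_antitone {k : ℕ} {s r : Fin k → ℝ≥0∞} (hs : ∀ i, s i ≠ 0) (hsr : ∀ i, s i ≤ r i)
    (f : (Fin k → ℕ) → ℝ≥0∞) : mixedNorm k r f ≤ mixedNorm k s f := by
  induction k with
  | zero => exact le_rfl
  | succ k ih =>
    rw [mixedNorm_succ, mixedNorm_succ]
    exact (lqNorm_antitone (hs 0) (hsr 0) _).trans
      (lqNorm_mono fun j => ih (fun i => hs _) (fun i => hsr _) _)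

/-- Minkowski's inequality for a finite family of infinite sums. -/
lemma sum_tsum_rpow_le {J : ℕ} (g : Fin J → ℕ → ℝ≥0∞) {a : ℝ} (ha : 1 ≤ a) :
    ∑ j, (∑' l, g j l) ^ a ≤ (∑' l, (∑ j, g j l ^ a) ^ (1 / a)) ^ a := by
  have ha0 : 0 < a := zero_lt_one.trans_le ha
  have hfin : ∀ s : Finset ℕ,
      (∑ j, (∑ l ∈ s, g j l) ^ a) ^ (1 / a) ≤ ∑ l ∈ s, (∑ j, g j l ^ a) ^ (1 / a) := by
    intro s
    induction s using Finset.cons_induction with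
    | empty => simp [ha0]
    | cons l s hl ih =>
      simp only [Finset.sum_cons]
      exact (ENNReal.Lp_add_le _ _ _ ha).trans (by gcongr)
  have hlim : Tendsto (fun s : Finset ℕ => ∑ j, (∑ l ∈ s, g j l) ^ a) atTop
      (𝓝 (∑ j, (∑' l, g j l) ^ a)) :=
    tendsto_finsetSum _ fun j _ =>
      ((ENNReal.continuous_rpow_const).tendsto _).comp ENNReal.summable.hasSum
  refine le_of_tendsto' hlim fun s => ?_
  calc ∑ j, (∑ l ∈ s, g j l) ^ a = ((∑ j, (∑ l ∈ s, g j l) ^ a) ^ (1 / a)) ^ a := by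
        rw [← ENNReal.rpow_mul, one_div, inv_mul_cancel₀ ha0.ne', ENNReal.rpow_one]
    _ ≤ _ := by
      gcongr
      exact (hfin s).trans (ENNReal.sum_le_tsum s)

end LqNorm

/-! ### Cotype of `ℓ_s` and of vector-valued `ℓ_d`. -/

section Cotype

variable {E F : Type*} [AddCommGroup E] [AddCommGroup F]

/-- The functional `N` has cotype `d` with constant `K ^ (1 / d)`. -/
def HasCotype (N : E → ℝ≥0∞) (d : ℝ) (K : ℝ≥0∞) : Prop :=
  ∀ (J : ℕ) (x : Fin J → E), ∑ j, N (x j) ^ d ≤ K * signAvg fun ε => N (radSum ε x) ^ d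

lemma HasCotype.comp {N : E → ℝ≥0∞} {d : ℝ} {K : ℝ≥0∞} (h : HasCotype N d K) (L : F →+ E) :
    HasCotype (fun y => N (L y)) d K := by
  intro J x
  simpa only [map_radSum] using h J fun j => L (x j)

/-- The left side grows by `ℓ_c ⊆ ℓ_d`, the right side by Jensen's inequality for the sign average.
-/
lemma HasCotype.mono {N : E → ℝ≥0∞} {c d : ℝ} {K : ℝ≥0∞} (h : HasCotype N c K) (hc : 0 < c)
    (hcd : c ≤ d) : HasCotype N d (K ^ (d / c)) := by
  intro J x
  have h1 : 1 ≤ d / c := (one_le_div hc).2 hcd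
  have h0 : 0 ≤ d / c := zero_le_one.trans h1
  calc ∑ j, N (x j) ^ d ≤ (∑ j, N (x j) ^ c) ^ (d / c) := by
        simpa only [tsum_fintype] using tsum_rpow_le_tsum_rpow hc hcd fun j => N (x j)
    _ ≤ (K * signAvg fun ε => N (radSum ε x) ^ c) ^ (d / c) := by
        gcongr
        exact h J x
    _ = K ^ (d / c) * (signAvg fun ε => N (radSum ε x) ^ c) ^ (d / c) :=
        ENNReal.mul_rpow_of_nonneg _ _ h0
    _ ≤ K ^ (d / c) * signAvg fun ε => (N (radSum ε x) ^ c) ^ (d / c) := by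
        gcongr
        exact signAvg_rpow_le _ h1
    _ = K ^ (d / c) * signAvg fun ε => N (radSum ε x) ^ d := by
        simp_rw [← ENNReal.rpow_mul, mul_div_cancel₀ d hc.ne']

/-- When the outer exponent equals the cotype exponent, the inequality is a coordinatewise sum, by
interchanging the sums. -/
lemma HasCotype.lqNorm {N : E → ℝ≥0∞} {d K : ℝ≥0∞} (hd0 : d ≠ 0) (hd : d ≠ ∞)
    (h : HasCotype N d.toReal K) :
    HasCotype (fun f : ℕ → E => lqNorm d fun l => N (f l)) d.toReal K := by
  intro J x
  simp_rw [lqNorm_rpow hd0 hd]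
  rw [← tsum_signAvg, ← ENNReal.tsum_mul_left,
    ← Summable.tsum_finsetSum fun _ _ => ENNReal.summable]
  refine ENNReal.tsum_le_tsum fun l => ?_
  have := h J fun j => x j l
  have h2 : ∀ ε, radSum ε x l = radSum ε fun j => x j l := fun ε =>
    map_radSum (Pi.evalAddMonoidHom (fun _ : ℕ => E) l) ε x
  simpa only [h2] using this

variable {𝕜 : Type*} [RCLike 𝕜]

lemma hasCotype_two_enorm : HasCotype (fun x : 𝕜 => ‖x‖ₑ) 2 1 := by
  intro J x
  have h : ∀ y : 𝕜, ‖y‖ₑ ^ (2 : ℝ) = ENNReal.ofReal (‖y‖ ^ 2) := by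
    intro y
    rw [← ofReal_norm, ENNReal.rpow_ofNat, ENNReal.ofReal_pow (norm_nonneg _)]
  simp_rw [h]
  rw [signAvg_ofReal fun ε => by positivity, sum_norm_radSum_sq,
    ← ENNReal.ofReal_sum_of_nonneg fun _ _ => by positivity, one_mul,
    mul_div_cancel_left₀ _ (by positivity)]

lemma khintchine_enorm {J : ℕ} (x : Fin J → 𝕜) :
    (∑ j, ‖x j‖ₑ ^ (2 : ℝ)) ^ (1 / 2 : ℝ) ≤ 2 * signAvg fun ε => ‖radSum ε x‖ₑ := by
  have h : ∀ y : 𝕜, ‖y‖ₑ ^ (2 : ℝ) = ENNReal.ofReal (‖y‖ ^ 2) := by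
    intro y
    rw [← ofReal_norm, ENNReal.rpow_ofNat, ENNReal.ofReal_pow (norm_nonneg _)]
  simp_rw [h, ← ofReal_norm]
  rw [signAvg_ofReal fun ε => norm_nonneg _,
    ← ENNReal.ofReal_sum_of_nonneg fun _ _ => by positivity,
    ENNReal.ofReal_rpow_of_nonneg (Finset.sum_nonneg fun _ _ => by positivity) (by norm_num),
    ← Real.sqrt_eq_rpow, show (2 : ℝ≥0∞) = ENNReal.ofReal 2 by simp,
    ← ENNReal.ofReal_mul (by norm_num)]
  exact ENNReal.ofReal_le_ofReal (sqrt_sum_sq_le_sum_norm_radSum x)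

/-- Minkowski's inequality with exponent `2 / s ≥ 1` moves the sum over `j` inside; Khintchine's
inequality is then applied in each coordinate. The constant is `(2 ^ s) ^ (2 / s) = 4`. -/
lemma hasCotype_lqNorm_of_le_two {s : ℝ≥0∞} (h1 : 1 ≤ s) (h2 : s ≤ 2) :
    HasCotype (fun f : ℕ → 𝕜 => lqNorm s fun l => ‖f l‖ₑ) 2 4 := by
  intro J x
  have hs0 : s ≠ 0 := (zero_lt_one.trans_le h1).ne'
  have hs : s ≠ ∞ := ne_top_of_le_ne_top (by simp) h2
  set r := s.toReal with hr
  have hr1 : 1 ≤ r := by simpa using ENNReal.toReal_mono hs h1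
  have hr2 : r ≤ 2 := by simpa using ENNReal.toReal_mono (by simp) h2
  have hr0 : 0 < r := zero_lt_one.trans_le hr1
  have ha : 1 ≤ 2 / r := (one_le_div hr0).2 hr2
  have hN : ∀ f : ℕ → ℝ≥0∞, lqNorm s f ^ (2 : ℝ) = (∑' l, f l ^ r) ^ (2 / r) := by
    intro f
    rw [lqNorm_of_ne_top hs, ← ENNReal.rpow_mul]
    congr 1
    ring
  have key : ∀ l, (∑ j, (‖x j l‖ₑ ^ r) ^ (2 / r)) ^ (1 / (2 / r)) ≤
      2 ^ r * signAvg fun ε => ‖radSum ε x l‖ₑ ^ r := by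
    intro l
    have e : ∀ ε, radSum ε x l = radSum ε fun j => x j l := fun ε =>
      map_radSum (Pi.evalAddMonoidHom (fun _ : ℕ => 𝕜) l) ε x
    simp_rw [e, ← ENNReal.rpow_mul, mul_div_cancel₀ (2 : ℝ) hr0.ne']
    calc (∑ j, ‖x j l‖ₑ ^ (2 : ℝ)) ^ (1 / (2 / r))
        = ((∑ j, ‖x j l‖ₑ ^ (2 : ℝ)) ^ (1 / 2 : ℝ)) ^ r := by
          rw [← ENNReal.rpow_mul]; congr 1; field_simp
      _ ≤ (2 * signAvg fun ε => ‖radSum ε fun j => x j l‖ₑ) ^ r := by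
          gcongr
          exact khintchine_enorm _
      _ ≤ _ := by
          rw [ENNReal.mul_rpow_of_nonneg _ _ hr0.le]
          gcongr
          exact signAvg_rpow_le _ hr1
  simp_rw [hN]
  refine (sum_tsum_rpow_le _ ha).trans ?_
  calc (∑' l, (∑ j, (‖x j l‖ₑ ^ r) ^ (2 / r)) ^ (1 / (2 / r))) ^ (2 / r)
      ≤ (∑' l, 2 ^ r * signAvg fun ε => ‖radSum ε x l‖ₑ ^ r) ^ (2 / r) := by
        gcongr with l
        exact key l
    _ = 4 * (signAvg fun ε => ∑' l, ‖radSum ε x l‖ₑ ^ r) ^ (2 / r) := by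
        rw [ENNReal.tsum_mul_left, tsum_signAvg, ENNReal.mul_rpow_of_nonneg _ _ (by positivity),
          ← ENNReal.rpow_mul, mul_div_cancel₀ (2 : ℝ) hr0.ne', ENNReal.rpow_ofNat]
        norm_num
    _ ≤ _ := by
        gcongr
        exact signAvg_rpow_le _ ha

lemma exists_hasCotype_lqNorm {s c : ℝ≥0∞} (h1 : 1 ≤ s) (hc : c = max s 2) (hct : c ≠ ∞) :
    ∃ K : ℝ≥0∞, K ≠ ∞ ∧ HasCotype (fun f : ℕ → 𝕜 => lqNorm s fun l => ‖f l‖ₑ) c.toReal K := by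
  rcases le_total s 2 with h | h
  · rw [max_eq_right h] at hc
    subst hc
    exact ⟨4, by simp, by simpa using hasCotype_lqNorm_of_le_two h1 h⟩
  · rw [max_eq_left h] at hc
    subst hc
    refine ⟨_, ?_, HasCotype.lqNorm (zero_lt_one.trans_le h1).ne' hct
      (hasCotype_two_enorm.mono two_pos ?_)⟩
    · simp
    · simpa using ENNReal.toReal_mono hct h

end Cotype

/-! ### Operators on `X_p` and the converse of Hölder's inequality. -/

section SeqSpace

variable {𝕜 : Type*} [RCLike 𝕜] {p : ℝ≥0∞} [Fact (1 ≤ p)]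

lemma seqSpace.norm_def (x : seqSpace 𝕜 p) : ‖x‖ = ‖(x : lp (fun _ : ℕ => 𝕜) p)‖ := rfl

lemma seqSpace.norm_e (j : ℕ) : ‖seqSpace.e 𝕜 p j‖ = 1 := by
  have h : 0 < p := zero_lt_one.trans_le Fact.out
  exact (lp.norm_single (E := fun _ : ℕ => 𝕜) h j (1 : 𝕜)).trans norm_one

lemma seqSpace.coe_sum_smul_e (J : ℕ) (z : ℕ → 𝕜) :
    ((∑ j ∈ Finset.range J, z j • seqSpace.e 𝕜 p j : seqSpace 𝕜 p) : lp (fun _ : ℕ => 𝕜) p) =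
      ∑ j ∈ Finset.range J, lp.single p j (z j) := by
  rw [AddSubmonoidClass.coe_finsetSum]
  refine Finset.sum_congr rfl fun j _ => ?_
  simp only [Submodule.coe_smul, seqSpace.e]
  rw [← lp.single_smul, smul_eq_mul, mul_one]

lemma seqSpace.sum_smul_e_apply (J : ℕ) (z : ℕ → 𝕜) (i : ℕ) :
    ((∑ j ∈ Finset.range J, z j • seqSpace.e 𝕜 p j : seqSpace 𝕜 p) : lp (fun _ : ℕ => 𝕜) p) i =
      if i < J then z i else 0 := by
  rw [seqSpace.coe_sum_smul_e, lp.coeFn_sum, Finset.sum_apply]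
  simp only [lp.coeFn_single, Pi.single_apply]
  simp

lemma seqSpace.norm_sum_smul_e_mono (J : ℕ) {z w : ℕ → 𝕜} (h : ∀ j < J, ‖z j‖ ≤ ‖w j‖) :
    ‖∑ j ∈ Finset.range J, z j • seqSpace.e 𝕜 p j‖ ≤
      ‖∑ j ∈ Finset.range J, w j • seqSpace.e 𝕜 p j‖ := by
  rw [seqSpace.norm_def, seqSpace.norm_def]
  refine lp.norm_mono (zero_lt_one.trans_le Fact.out : 0 < p).ne' fun i => ?_
  rw [seqSpace.sum_smul_e_apply, seqSpace.sum_smul_e_apply]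
  split_ifs with hi
  · exact h i hi
  · exact le_rfl

lemma seqSpace.enorm_sum_smul_e (hp : p ≠ ∞) (J : ℕ) (z : ℕ → 𝕜) :
    ‖∑ j ∈ Finset.range J, z j • seqSpace.e 𝕜 p j‖ₑ =
      (∑ j ∈ Finset.range J, ‖z j‖ₑ ^ p.toReal) ^ (1 / p.toReal) := by
  have hp0 : 0 < p.toReal :=
    ENNReal.toReal_pos (zero_lt_one.trans_le Fact.out : 0 < p).ne' hp
  have h := lp.norm_sum_single (E := fun _ : ℕ => 𝕜) hp0 z (Finset.range J)
  rw [← seqSpace.coe_sum_smul_e, ← seqSpace.norm_def] at h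
  suffices h' : ‖∑ j ∈ Finset.range J, z j • seqSpace.e 𝕜 p j‖ₑ ^ p.toReal =
      ∑ j ∈ Finset.range J, ‖z j‖ₑ ^ p.toReal by
    rw [← h', ← ENNReal.rpow_mul, mul_one_div_cancel hp0.ne', ENNReal.rpow_one]
  rw [← ofReal_norm, ENNReal.ofReal_rpow_of_nonneg (norm_nonneg _) hp0.le, h,
    ENNReal.ofReal_sum_of_nonneg fun _ _ => by positivity]
  refine Finset.sum_congr rfl fun j _ => ?_
  rw [← ofReal_norm, ENNReal.ofReal_rpow_of_nonneg (norm_nonneg _) hp0.le]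

lemma seqSpace.norm_sum_e_le (hp : p = ∞) (J : ℕ) :
    ‖∑ j ∈ Finset.range J, (1 : 𝕜) • seqSpace.e 𝕜 p j‖ ≤ 1 := by
  subst hp
  rw [seqSpace.norm_def]
  refine lp.norm_le_of_forall_le zero_le_one fun i => ?_
  rw [seqSpace.sum_smul_e_apply J fun _ => (1 : 𝕜)]
  split_ifs <;> simp

/-- Converse of Hölder's inequality: a sequence that multiplies `X_p` into `ℓ_d` lies in `ℓ_D`
where `1 / D = 1 / d - 1 / p > 0`. -/
lemma lqNorm_le_of_forall_mul_le (𝕜 : Type*) [RCLike 𝕜] {d D M : ℝ≥0∞} {b : ℕ → ℝ≥0∞}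
    (hd : d ≠ 0) (hD : D ≠ ∞) (hDd : D⁻¹ = d⁻¹ - p⁻¹) (hb : ∀ j, b j ≠ ∞)
    (h : ∀ (J : ℕ) (w : ℕ → NNReal), ∑ j ∈ Finset.range J, (w j * b j) ^ d.toReal ≤
      (M * ‖∑ j ∈ Finset.range J, (((w j : ℝ) : 𝕜)) • seqSpace.e 𝕜 p j‖ₑ) ^ d.toReal) :
    lqNorm D b ≤ M := by
  have hp0 : p ≠ 0 := (zero_lt_one.trans_le Fact.out : 0 < p).ne'
  have hlt : p⁻¹ < d⁻¹ := by
    rw [← tsub_pos_iff_lt, ← hDd]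
    exact ENNReal.inv_pos.2 hD
  have hdt : d ≠ ∞ := by
    rintro rfl
    simp at hlt
  have hD0 : D ≠ 0 := by
    rintro rfl
    have : d⁻¹ - p⁻¹ ≠ ∞ := ne_top_of_le_ne_top (ENNReal.inv_ne_top.2 hd) tsub_le_self
    exact this (by rw [← hDd]; simp)
  have hd' := ENNReal.toReal_pos hd hdt
  have hD' := ENNReal.toReal_pos hD0 hD
  rw [lqNorm_of_ne_top hD, one_div, ENNReal.rpow_inv_le_iff hD']
  refine ENNReal.tsum_le_of_sum_range_le fun J => ?_
  -- For `p = ∞` one has `D = d`, and the constant weight `1` is the extremal choice.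
  by_cases hpt : p = ∞
  · have hdD : D = d := by
      rw [hpt] at hDd
      simpa using hDd
    have h1 := h J fun _ => 1
    rw [hdD]
    simp only [ENNReal.coe_one, one_mul, NNReal.coe_one, RCLike.ofReal_one] at h1
    refine h1.trans ?_
    gcongr
    refine mul_le_of_le_one_right' ?_
    rw [← ofReal_norm, ← ENNReal.ofReal_one]
    exact ENNReal.ofReal_le_ofReal (seqSpace.norm_sum_e_le hpt J)
  have hp' := ENNReal.toReal_pos hp0 hpt
  have hr : D.toReal⁻¹ = d.toReal⁻¹ - p.toReal⁻¹ := by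
    have := congrArg ENNReal.toReal hDd
    rwa [ENNReal.toReal_sub_of_le hlt.le (ENNReal.inv_ne_top.2 hd), ENNReal.toReal_inv,
      ENNReal.toReal_inv, ENNReal.toReal_inv] at this
  generalize D.toReal = D' at *
  generalize d.toReal = d' at *
  -- The equality case of Hölder's inequality: with `w = b ^ (D / p)`, both `(w b) ^ d` and `w ^ p`
  -- equal `b ^ D`. The bound becomes `S ≤ M ^ d * S ^ (d / p)`, and the partial sum `S` is finite,
  -- so a power of it can be cancelled.
  have h1 := h J fun j => (b j).toNNReal ^ (D' / p.toReal)
  rw [seqSpace.enorm_sum_smul_e hpt] at h1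
  have hw : ∀ j, (((b j).toNNReal ^ (D' / p.toReal) : NNReal) : ℝ≥0∞) =
      b j ^ (D' / p.toReal) := by
    intro j
    rw [ENNReal.coe_rpow_of_nonneg _ (by positivity), ENNReal.coe_toNNReal (hb j)]
  have hw2 : ∀ j, ‖((((b j).toNNReal ^ (D' / p.toReal) : NNReal) : ℝ) : 𝕜)‖ₑ =
      b j ^ (D' / p.toReal) := by
    intro j
    rw [← hw, ← ofReal_norm, RCLike.norm_ofReal, abs_of_nonneg (NNReal.coe_nonneg _),
      ENNReal.ofReal_coe_nnreal]
  simp_rw [hw, hw2] at h1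
  generalize p.toReal = p' at *
  have e1 : ∀ j, (b j ^ (D' / p') * b j) ^ d' = b j ^ D' := by
    intro j
    nth_rewrite 2 [← ENNReal.rpow_one (b j)]
    rw [← ENNReal.rpow_add_of_nonneg _ _ (by positivity) zero_le_one, ← ENNReal.rpow_mul]
    congr 1
    field_simp at hr ⊢
    linarith
  have e2 : ∀ j, (b j ^ (D' / p')) ^ p' = b j ^ D' := by
    intro j
    rw [← ENNReal.rpow_mul, div_mul_cancel₀ _ hp'.ne']
  simp_rw [e1, e2] at h1
  set S := ∑ j ∈ Finset.range J, b j ^ D' with hS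
  have hSt : S ≠ ∞ :=
    ENNReal.sum_ne_top.2 fun j _ => ENNReal.rpow_ne_top_of_nonneg hD'.le (hb j)
  by_cases hS0 : S = 0
  · rw [hS0]; exact zero_le
  have h2 : S ≤ M ^ d' * S ^ (d' / p') := by
    refine h1.trans_eq ?_
    rw [ENNReal.mul_rpow_of_nonneg _ _ hd'.le, ← ENNReal.rpow_mul]
    congr 2
    ring
  have h3 : S ^ (d' / D') ≤ M ^ d' := by
    have e3 : d' / D' = 1 - d' / p' := by
      field_simp at hr ⊢
      linarith
    rw [e3, ENNReal.rpow_sub _ _ hS0 hSt, ENNReal.rpow_one]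
    exact ENNReal.div_le_of_le_mul h2
  calc S = (S ^ (d' / D')) ^ (D' / d') := by
        rw [← ENNReal.rpow_mul, div_mul_div_cancel₀ hD'.ne', div_self hd'.ne', ENNReal.rpow_one]
    _ ≤ (M ^ d') ^ (D' / d') := by gcongr
    _ = M ^ D' := by rw [← ENNReal.rpow_mul, mul_div_cancel₀ _ hd'.ne']

/-- Cotype applied to the vectors `w_j T e_j` bounds `∑ (w_j N(T e_j)) ^ d` by an average over
signs. Every term of that average is at most `(M ‖∑ w_j e_j‖) ^ d`, since the norm of `X_p` depends
only on the moduli of the coordinates. -/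
lemma lqNorm_le_of_hasCotype {E : Type*} [AddCommGroup E] [Module 𝕜 E] {N : E → ℝ≥0∞}
    (hN : ∀ (c : 𝕜) (x : E), N (c • x) = ‖c‖ₑ * N x) {d D K M : ℝ≥0∞}
    (hd : d ≠ 0) (hD : D ≠ ∞) (hDd : D⁻¹ = d⁻¹ - p⁻¹) (hcot : HasCotype N d.toReal K)
    (T : seqSpace 𝕜 p →ₗ[𝕜] E) (hM : M ≠ ∞) (hT : ∀ x, N (T x) ≤ M * ‖x‖ₑ) :
    lqNorm D (fun j => N (T (seqSpace.e 𝕜 p j))) ≤ K ^ (1 / d.toReal) * M := by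
  have hdt : d ≠ ∞ := by
    rintro rfl
    simp at hDd
    exact hD hDd
  have hd' := ENNReal.toReal_pos hd hdt
  have hbt : ∀ j, N (T (seqSpace.e 𝕜 p j)) ≠ ∞ := by
    intro j
    refine ne_top_of_le_ne_top hM ((hT _).trans ?_)
    rw [← ofReal_norm, seqSpace.norm_e]
    simp
  refine lqNorm_le_of_forall_mul_le 𝕜 hd hD hDd hbt fun J w => ?_
  have key := hcot J fun j => T (((w j : ℝ) : 𝕜) • seqSpace.e 𝕜 p (j : ℕ))
  have hnorm : ∀ r : NNReal, ‖((r : ℝ) : 𝕜)‖ₑ = r := by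
    intro r
    rw [← ofReal_norm, RCLike.norm_ofReal, abs_of_nonneg (NNReal.coe_nonneg _),
      ENNReal.ofReal_coe_nnreal]
  simp_rw [map_smul, hN, hnorm] at key
  rw [Fin.sum_univ_eq_sum_range
    (fun j => ((w j : ℝ≥0∞) * N (T (seqSpace.e 𝕜 p j))) ^ d.toReal)] at key
  refine key.trans ?_
  set y := ∑ j ∈ Finset.range J, ((w j : ℝ) : 𝕜) • seqSpace.e 𝕜 p j with hy
  have hε : ∀ ε : Fin J → Bool,
      N (radSum ε fun j => ((w j : ℝ) : 𝕜) • T (seqSpace.e 𝕜 p (j : ℕ))) ≤ M * ‖y‖ₑ := by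
    intro ε
    have e : (radSum ε fun j => ((w j : ℝ) : 𝕜) • T (seqSpace.e 𝕜 p (j : ℕ))) =
        T (radSum ε fun j => ((w j : ℝ) : 𝕜) • seqSpace.e 𝕜 p (j : ℕ)) := by
      have := map_radSum T.toAddMonoidHom ε fun j => ((w j : ℝ) : 𝕜) • seqSpace.e 𝕜 p (j : ℕ)
      simpa only [LinearMap.toAddMonoidHom_coe, map_smul] using this.symm
    rw [e]
    refine (hT _).trans ?_
    gcongr
    set z : ℕ → 𝕜 := fun j => if h : j < J then
      (bif ε ⟨j, h⟩ then ((w j : ℝ) : 𝕜) else -((w j : ℝ) : 𝕜)) else 0 with hz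
    have e2 : (radSum ε fun j => ((w j : ℝ) : 𝕜) • seqSpace.e 𝕜 p (j : ℕ)) =
        ∑ j ∈ Finset.range J, z j • seqSpace.e 𝕜 p j := by
      rw [← Fin.sum_univ_eq_sum_range (fun j => z j • seqSpace.e 𝕜 p j)]
      refine Finset.sum_congr rfl fun j _ => ?_
      simp only [hz, j.2, dif_pos, Fin.eta]
      cases ε j <;> simp
    rw [e2, ← ofReal_norm, ← ofReal_norm]
    refine ENNReal.ofReal_le_ofReal (seqSpace.norm_sum_smul_e_mono J fun j hj => ?_)
    simp only [hz, hj, dif_pos]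
    cases ε ⟨j, hj⟩ <;> simp
  calc K * signAvg (fun ε => N (radSum ε fun j : Fin J =>
          ((w j : ℝ) : 𝕜) • T (seqSpace.e 𝕜 p (j : ℕ))) ^ d.toReal)
      ≤ K * (M * ‖y‖ₑ) ^ d.toReal := by
        gcongr
        exact signAvg_le fun ε => ENNReal.rpow_le_rpow (hε ε) hd'.le
    _ = (K ^ (1 / d.toReal) * M * ‖y‖ₑ) ^ d.toReal := by
        rw [mul_assoc, ENNReal.mul_rpow_of_nonneg (K ^ _) _ hd'.le, ← ENNReal.rpow_mul, one_div,
          inv_mul_cancel₀ hd'.ne', ENNReal.rpow_one]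

lemma conjExponent_eq_inv_one_sub_inv {p : ℝ≥0∞} (hp : 1 ≤ p) : p.conjExponent = (1 - p⁻¹)⁻¹ :=
  have := ENNReal.HolderConjugate.inv_one_sub_inv' hp
  ENNReal.HolderConjugate.conjExponent_eq

/-- The one-variable case. Unimodular factors `c j` align the values on the `e_j`, so the converse
of Hölder's inequality applies with `d = 1`. -/
lemma lqNorm_functional_le (φ : seqSpace 𝕜 p →L[𝕜] 𝕜) :
    lqNorm p.conjExponent (fun j => ‖φ (seqSpace.e 𝕜 p j)‖ₑ) ≤ ‖φ‖ₑ := by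
  have hle : ∀ j, ‖φ (seqSpace.e 𝕜 p j)‖ₑ ≤ ‖φ‖ₑ := by
    intro j
    rw [← ofReal_norm, ← ofReal_norm]
    refine ENNReal.ofReal_le_ofReal ((φ.le_opNorm _).trans_eq ?_)
    rw [seqSpace.norm_e, mul_one]
  by_cases hD : p.conjExponent = ∞
  · rw [hD, lqNorm_top]
    exact iSup_le hle
  refine lqNorm_le_of_forall_mul_le 𝕜 (p := p) (d := 1) one_ne_zero hD ?_ (fun j => enorm_ne_top)
    fun J w => ?_
  · rw [conjExponent_eq_inv_one_sub_inv Fact.out, inv_inv, inv_one]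
  simp only [ENNReal.toReal_one, ENNReal.rpow_one]
  choose c hc1 hc using fun j => RCLike.exists_norm_eq_mul_self (φ (seqSpace.e 𝕜 p j))
  set x := ∑ j ∈ Finset.range J, (((w j : ℝ) : 𝕜) * c j) • seqSpace.e 𝕜 p j with hx
  have h1 : φ x = ((∑ j ∈ Finset.range J, (w j : ℝ) * ‖φ (seqSpace.e 𝕜 p j)‖ : ℝ) : 𝕜) := by
    rw [hx, map_sum, RCLike.ofReal_sum]
    refine Finset.sum_congr rfl fun j _ => ?_
    rw [map_smul, smul_eq_mul, RCLike.ofReal_mul, hc, mul_assoc]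
  have h2 : ∑ j ∈ Finset.range J, (w j : ℝ) * ‖φ (seqSpace.e 𝕜 p j)‖ ≤ ‖φ‖ * ‖x‖ := by
    have h3 := φ.le_opNorm x
    rw [h1, RCLike.norm_ofReal] at h3
    exact (le_abs_self _).trans h3
  have h4 : ‖x‖ ≤ ‖∑ j ∈ Finset.range J, (((w j : ℝ) : 𝕜)) • seqSpace.e 𝕜 p j‖ :=
    seqSpace.norm_sum_smul_e_mono J fun j _ => by rw [norm_mul, hc1, mul_one]
  have h5 := ENNReal.ofReal_le_ofReal
    (h2.trans (mul_le_mul_of_nonneg_left h4 (norm_nonneg φ)))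
  rw [ENNReal.ofReal_mul (norm_nonneg φ), ENNReal.ofReal_sum_of_nonneg fun _ _ => by positivity,
    ofReal_norm, ofReal_norm] at h5
  refine le_trans (le_of_eq (Finset.sum_congr rfl fun j _ => ?_)) h5
  rw [ENNReal.ofReal_mul (NNReal.coe_nonneg _), ENNReal.ofReal_coe_nnreal, ofReal_norm]

end SeqSpace

/-! ### The recursion for the exponents `δ`. -/

section Exponents

lemma delta_succ {n : ℕ} (s : Fin (n + 1) → ℝ≥0∞) (k : Fin n) :
    delta s k.succ = delta (fun i => s i.succ) k := by
  unfold delta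
  rw [← Fin.map_succEmb_Ici, Finset.sum_map]
  rfl

lemma delta_zero {n : ℕ} (s : Fin (n + 1) → ℝ≥0∞) : delta s 0 = (1 - ∑ i, (s i)⁻¹)⁻¹ := by
  unfold delta
  congr 3
  ext i
  simp

/-- Truncated subtractions compose, so the recursion holds even after the value `0` is reached. -/
lemma inv_delta_zero {n : ℕ} (s : Fin (n + 2) → ℝ≥0∞) :
    (delta s 0)⁻¹ = (delta (fun i => s i.succ) 0)⁻¹ - (s 0)⁻¹ := by
  rw [delta_zero, delta_zero, inv_inv, inv_inv, Fin.sum_univ_succ,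
    tsub_add_eq_tsub_tsub_swap]

lemma one_le_delta {n : ℕ} (s : Fin n → ℝ≥0∞) (k : Fin n) : 1 ≤ delta s k :=
  ENNReal.one_le_inv.2 tsub_le_self

/-- The exponents `p_1, …, p_{m-1}, min {p_m, 2}`. -/
noncomputable def truncExp {k : ℕ} (p : Fin (k + 1) → ℝ≥0∞) : Fin (k + 1) → ℝ≥0∞ :=
  Fin.snoc (α := fun _ => ℝ≥0∞) (fun i : Fin k => p i.castSucc) (min (p (Fin.last k)) 2)

/-- The smallest admissible exponents of the mixed norm. -/
noncomputable def optExp {k : ℕ} (p : Fin (k + 1) → ℝ≥0∞) : Fin (k + 1) → ℝ≥0∞ :=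
  Fin.snoc (α := fun _ => ℝ≥0∞) (fun i : Fin k => delta (truncExp p) i.castSucc)
    (p (Fin.last k)).conjExponent

lemma truncExp_succ {k : ℕ} (p : Fin (k + 2) → ℝ≥0∞) :
    (fun i => truncExp p i.succ) = truncExp fun i => p i.succ := by
  funext i
  refine Fin.lastCases ?_ (fun i => ?_) i
  · rw [Fin.succ_last]
    simp [truncExp]
  · rw [Fin.succ_castSucc]
    simp only [truncExp, Fin.snoc_castSucc]
    rfl

lemma truncExp_zero {k : ℕ} (p : Fin (k + 2) → ℝ≥0∞) : truncExp p 0 = p 0 := by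
  rw [← Fin.castSucc_zero]
  simp [truncExp]

lemma optExp_succ {k : ℕ} (p : Fin (k + 2) → ℝ≥0∞) :
    (fun i => optExp p i.succ) = optExp fun i => p i.succ := by
  funext i
  refine Fin.lastCases ?_ (fun i => ?_) i
  · rw [Fin.succ_last]
    simp [optExp]
  · rw [Fin.succ_castSucc]
    simp only [optExp, Fin.snoc_castSucc]
    rw [← Fin.succ_castSucc, delta_succ, truncExp_succ]

lemma optExp_zero {k : ℕ} (p : Fin (k + 2) → ℝ≥0∞) : optExp p 0 = delta (truncExp p) 0 := by
  rw [← Fin.castSucc_zero]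
  simp [optExp]

lemma optExp_ne_zero {k : ℕ} (p : Fin (k + 1) → ℝ≥0∞) (i : Fin (k + 1)) : optExp p i ≠ 0 := by
  refine Fin.lastCases ?_ (fun i => ?_) i
  · simp [optExp, ENNReal.conjExponent]
  · simp only [optExp, Fin.snoc_castSucc]
    exact (zero_lt_one.trans_le (one_le_delta _ _)).ne'

/-- Identifies the first `δ` with the cotype exponent of `ℓ_{p^*}`; this is the role of the
truncation at `2`. -/
lemma delta_truncExp_one (p : Fin 1 → ℝ≥0∞) (hp : 1 ≤ p 0) :
    delta (truncExp p) 0 = max (p 0).conjExponent 2 := by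
  have h : truncExp p 0 = min (p 0) 2 := by
    rw [show (0 : Fin 1) = Fin.last 0 from rfl]
    simp only [truncExp, Fin.snoc_last]
  have hanti : Antitone fun x : ℝ≥0∞ => (1 - x⁻¹)⁻¹ := by
    intro x y hxy
    exact ENNReal.inv_le_inv.2 (tsub_le_tsub_left (ENNReal.inv_le_inv.2 hxy) 1)
  rw [delta_zero, Fin.sum_univ_one, h, conjExponent_eq_inv_one_sub_inv hp]
  have : (1 - (min (p 0) 2)⁻¹)⁻¹ = max (1 - (p 0)⁻¹)⁻¹ (1 - 2⁻¹)⁻¹ := hanti.map_min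
  rw [this, ENNReal.one_sub_inv_two, inv_inv]

end Exponents

/-! ### Homogeneity of mixed norms. -/

section Homogeneity

lemma lqNorm_mul_left {q : ℝ≥0∞} (hq : q ≠ 0) (c : ℝ≥0∞) (f : ℕ → ℝ≥0∞) :
    lqNorm q (fun j => c * f j) = c * lqNorm q f := by
  by_cases h : q = ∞
  · rw [h, lqNorm_top, lqNorm_top, ENNReal.mul_iSup]
  · have h0 := ENNReal.toReal_pos hq h
    rw [lqNorm_of_ne_top h, lqNorm_of_ne_top h]
    simp_rw [ENNReal.mul_rpow_of_nonneg _ _ h0.le]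
    rw [ENNReal.tsum_mul_left, ENNReal.mul_rpow_of_nonneg _ _ (by positivity),
      ← ENNReal.rpow_mul, mul_one_div_cancel h0.ne', ENNReal.rpow_one]

lemma mixedNorm_mul_left {k : ℕ} {s : Fin k → ℝ≥0∞} (hs : ∀ i, s i ≠ 0) (c : ℝ≥0∞)
    (f : (Fin k → ℕ) → ℝ≥0∞) : mixedNorm k s (fun t => c * f t) = c * mixedNorm k s f := by
  induction k with
  | zero => rfl
  | succ k ih =>
    simp only [mixedNorm_succ]
    simp_rw [ih (s := fun i => s i.succ) (fun i => hs _)]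
    exact lqNorm_mul_left (hs 0) _ _

end Homogeneity

/-! ### Sufficiency: induction on the number of variables. -/

section Sufficiency

variable {𝕜 : Type*} [RCLike 𝕜]

/-- The mixed norm of a scalar array. -/
noncomputable def arrayNorm {k : ℕ} (s : Fin k → ℝ≥0∞) (f : (Fin k → ℕ) → 𝕜) : ℝ≥0∞ :=
  mixedNorm k s fun t => ‖f t‖ₑ

lemma arrayNorm_smul {k : ℕ} {s : Fin k → ℝ≥0∞} (hs : ∀ i, s i ≠ 0) (c : 𝕜)
    (f : (Fin k → ℕ) → 𝕜) : arrayNorm s (c • f) = ‖c‖ₑ * arrayNorm s f := by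
  simp only [arrayNorm, Pi.smul_apply, smul_eq_mul, enorm_mul]
  exact mixedNorm_mul_left hs _ _

/-- The slices of an array along its first index. -/
def sliceHom (𝕜 : Type*) [RCLike 𝕜] (k : ℕ) :
    ((Fin (k + 1) → ℕ) → 𝕜) →+ (ℕ → (Fin k → ℕ) → 𝕜) where
  toFun f j js := f (Fin.cons j js)
  map_zero' := rfl
  map_add' _ _ := rfl

/-- The inner arrays have cotype equal to the next `δ`, which is at most the outer one. Raising the
cotype to the outer exponent lets the outer `ℓ_δ` layer preserve it. -/
lemma exists_hasCotype_arrayNorm {k : ℕ} (p : Fin (k + 1) → ℝ≥0∞) (hp : ∀ i, 1 ≤ p i)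
    (hD : delta (truncExp p) 0 ≠ ∞) :
    ∃ K : ℝ≥0∞, K ≠ ∞ ∧
      HasCotype (arrayNorm (𝕜 := 𝕜) (optExp p)) (delta (truncExp p) 0).toReal K := by
  induction k with
  | zero =>
    have hs : 1 ≤ (p 0).conjExponent := by simp [ENNReal.conjExponent]
    obtain ⟨K, hK, h⟩ := exists_hasCotype_lqNorm (𝕜 := 𝕜) hs (delta_truncExp_one p (hp 0)) hD
    let L : ((Fin 1 → ℕ) → 𝕜) →+ (ℕ → 𝕜) :=
      { toFun := fun f j => f (Fin.cons j Fin.elim0)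
        map_zero' := rfl
        map_add' := fun _ _ => rfl }
    exact ⟨K, hK, h.comp L⟩
  | succ k ih =>
    have hinv := inv_delta_zero (truncExp p)
    rw [truncExp_succ] at hinv
    have hle : delta (truncExp fun i => p i.succ) 0 ≤ delta (truncExp p) 0 := by
      rw [← ENNReal.inv_le_inv, hinv]
      exact tsub_le_self
    have hD' := ne_top_of_le_ne_top hD hle
    obtain ⟨K, hK, h⟩ := ih (fun i => p i.succ) (fun i => hp _) hD'
    have h0 := ENNReal.toReal_pos (zero_lt_one.trans_le (one_le_delta _ _)).ne' hD'
    have hrle := ENNReal.toReal_mono hD hle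
    have hcot := (HasCotype.lqNorm (zero_lt_one.trans_le (one_le_delta _ _)).ne' hD
      (h.mono h0 hrle)).comp (sliceHom 𝕜 (k + 1))
    refine ⟨K ^ ((delta (truncExp p) 0).toReal / (delta (truncExp fun i => p i.succ) 0).toReal),
      ENNReal.rpow_ne_top_of_nonneg (by positivity) hK, ?_⟩
    convert hcot using 1
    funext f
    rw [arrayNorm, mixedNorm_succ, optExp_zero, optExp_succ]
    rfl

/-- The array of coefficients of a multilinear form on sequence spaces. -/
noncomputable def coeffArray {k : ℕ} {p : Fin k → ℝ≥0∞} [∀ i, Fact (1 ≤ p i)]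
    (A : ContinuousMultilinearMap 𝕜 (fun i => seqSpace 𝕜 (p i)) 𝕜) : (Fin k → ℕ) → 𝕜 :=
  fun t => A fun i => seqSpace.e 𝕜 (p i) (t i)

theorem exists_arrayNorm_coeffArray_le {k : ℕ} (p : Fin (k + 1) → ℝ≥0∞) [∀ i, Fact (1 ≤ p i)] :
    ∃ C : ℝ≥0∞, C ≠ ∞ ∧ ∀ A : ContinuousMultilinearMap 𝕜 (fun i => seqSpace 𝕜 (p i)) 𝕜,
      arrayNorm (optExp p) (coeffArray A) ≤ C * ‖A‖ₑ := by
  induction k with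
  | zero =>
    refine ⟨1, by simp, fun A => ?_⟩
    have h := lqNorm_functional_le
      ((ContinuousMultilinearMap.apply 𝕜 (fun i : Fin 0 => seqSpace 𝕜 (p i.succ)) 𝕜
        (fun i => i.elim0)).comp A.curryLeft)
    rw [one_mul]
    have hle : ‖(ContinuousMultilinearMap.apply 𝕜 (fun i : Fin 0 => seqSpace 𝕜 (p i.succ)) 𝕜
        (fun i => i.elim0)).comp A.curryLeft‖ ≤ ‖A‖ := by
      refine ContinuousLinearMap.opNorm_le_bound _ (norm_nonneg _) fun x => ?_
      refine (A.le_opNorm _).trans_eq ?_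
      simp
    refine le_trans (le_of_eq ?_) (h.trans ?_)
    · rw [arrayNorm, mixedNorm_succ]
      congr 1
      funext j
      simp only [mixedNorm, coeffArray, ContinuousLinearMap.comp_apply,
        ContinuousMultilinearMap.apply_apply, ContinuousMultilinearMap.curryLeft_apply]
      congr 2
      funext i
      refine Fin.cases ?_ (fun i => i.elim0) i
      rfl
    · rw [← ofReal_norm, ← ofReal_norm]
      exact ENNReal.ofReal_le_ofReal hle
  | succ k ih =>
    obtain ⟨C, hC, hbound⟩ := ih fun i => p i.succ
    let T (A : ContinuousMultilinearMap 𝕜 (fun i => seqSpace 𝕜 (p i)) 𝕜) :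
        seqSpace 𝕜 (p 0) →ₗ[𝕜] ((Fin (k + 1) → ℕ) → 𝕜) :=
      { toFun := fun x => coeffArray (p := fun i => p i.succ) (A.curryLeft x)
        map_add' := fun x y => by rw [map_add]; rfl
        map_smul' := fun c x => by rw [map_smul]; rfl }
    have hT : ∀ A x, arrayNorm (optExp fun i => p i.succ) (T A x) ≤ C * ‖A‖ₑ * ‖x‖ₑ := by
      intro A x
      refine (hbound (A.curryLeft x)).trans ?_
      rw [mul_assoc]
      gcongr
      rw [← ofReal_norm, ← ofReal_norm, ← ofReal_norm, ← ENNReal.ofReal_mul (norm_nonneg _)]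
      refine ENNReal.ofReal_le_ofReal ?_
      exact ContinuousMultilinearMap.opNorm_le_bound (by positivity)
        fun v => A.norm_map_cons_le x v
    have hslice : ∀ A : ContinuousMultilinearMap 𝕜 (fun i => seqSpace 𝕜 (p i)) 𝕜,
        arrayNorm (optExp p) (coeffArray A) = lqNorm (delta (truncExp p) 0) fun j =>
          arrayNorm (optExp fun i => p i.succ) (T A (seqSpace.e 𝕜 (p 0) j)) := by
      intro A
      rw [arrayNorm, mixedNorm_succ, optExp_zero, optExp_succ]
      congr 1
      funext j
      simp only [arrayNorm]
      congr 1
      funext t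
      simp only [T, coeffArray, LinearMap.coe_mk, AddHom.coe_mk,
        ContinuousMultilinearMap.curryLeft_apply]
      congr 2
      funext i
      refine Fin.cases ?_ (fun i => ?_) i <;> rfl
    -- With outer exponent `∞` only the supremum of the slice norms is needed, and `‖e_j‖ = 1`.
    by_cases hD : delta (truncExp p) 0 = ∞
    · refine ⟨C, hC, fun A => ?_⟩
      rw [hslice, hD, lqNorm_top]
      refine iSup_le fun j => (hT A _).trans_eq ?_
      rw [← ofReal_norm (seqSpace.e 𝕜 (p 0) j), seqSpace.norm_e, ENNReal.ofReal_one, mul_one]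
    · have hinv := inv_delta_zero (truncExp p)
      rw [truncExp_succ, truncExp_zero] at hinv
      have hD' : delta (truncExp fun i => p i.succ) 0 ≠ ∞ := by
        refine ne_top_of_le_ne_top hD ?_
        rw [← ENNReal.inv_le_inv, hinv]
        exact tsub_le_self
      have hD0 := (zero_lt_one.trans_le (one_le_delta (truncExp fun i => p i.succ) 0)).ne'
      obtain ⟨K, hK, hcot⟩ := exists_hasCotype_arrayNorm (𝕜 := 𝕜) (fun i => p i.succ)
        (fun i => Fact.out) hD'
      refine ⟨K ^ (1 / (delta (truncExp fun i => p i.succ) 0).toReal) * C,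
        ENNReal.mul_ne_top (ENNReal.rpow_ne_top_of_nonneg (by positivity) hK) hC, fun A => ?_⟩
      rw [hslice, mul_assoc]
      exact lqNorm_le_of_hasCotype (arrayNorm_smul (optExp_ne_zero _)) hD0 hD hinv hcot (T A)
        (ENNReal.mul_ne_top hC enorm_ne_top) (hT A)

end Sufficiency

/-! ### Hölder's inequality for arbitrary exponents. -/

section Hoelder

lemma toReal_one_sub_sum {ι : Type*} (S : Finset ι) {f : ι → ℝ≥0∞} (hf : ∀ i ∈ S, f i ≠ ∞) :
    (1 - ∑ i ∈ S, f i).toReal = max (1 - ∑ i ∈ S, (f i).toReal) 0 := by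
  have hS : ∑ i ∈ S, f i ≠ ∞ := ENNReal.sum_ne_top.2 hf
  rw [← ENNReal.toReal_sum hf]
  rcases le_total (∑ i ∈ S, f i) 1 with h | h
  · rw [ENNReal.toReal_sub_of_le h (by simp), ENNReal.toReal_one, max_eq_left]
    have := ENNReal.toReal_mono (by simp) h
    simpa using this
  · rw [tsub_eq_zero_of_le h, ENNReal.toReal_zero, max_eq_right]
    have := ENNReal.toReal_mono hS h
    simpa using this

/-- Weighted arithmetic-geometric means, summed over `j`. If `U = ∑ 1/p_i < 1`, a constant factor
`1/N` of weight `θ = 1 - U` completes the weights and costs `N ^ θ`; if `U > 1`, the weights are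
divided by `U`, which is harmless because all entries are at most `1`. -/
lemma sum_prod_le_of_le_one {ι : Type*} (S : Finset ι) {p : ι → ℝ≥0∞} (hp : ∀ i ∈ S, 1 ≤ p i)
    {N : ℕ} (hN : 0 < N) {c : ι → ℕ → ℝ} (hc0 : ∀ i ∈ S, ∀ j, 0 ≤ c i j)
    (hc1 : ∀ i ∈ S, ∀ j < N, c i j ≤ 1)
    (hsum : ∀ i ∈ S, p i ≠ ∞ → ∑ j ∈ Finset.range N, c i j ^ (p i).toReal ≤ 1) :
    ∑ j ∈ Finset.range N, ∏ i ∈ S, c i j ≤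
      (N : ℝ) ^ (1 - ∑ i ∈ S, (p i)⁻¹).toReal := by
  have hinv : ∀ i ∈ S, (p i)⁻¹ ≠ ∞ := fun i hi =>
    ENNReal.inv_ne_top.2 (zero_lt_one.trans_le (hp i hi)).ne'
  rw [toReal_one_sub_sum S hinv]
  set u : ι → ℝ := fun i => ((p i)⁻¹).toReal with hu
  set U := ∑ i ∈ S, u i with hU
  have hu0 : ∀ i, 0 ≤ u i := fun i => ENNReal.toReal_nonneg
  set V := max U 1 with hV
  have hV1 : 1 ≤ V := le_max_right _ _
  have hV0 : 0 < V := zero_lt_one.trans_le hV1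
  set v : ι → ℝ := fun i => u i / V with hv
  have hv0 : ∀ i, 0 ≤ v i := fun i => div_nonneg (hu0 i) hV0.le
  set θ := max (1 - U) 0 with hθ
  have hθ0 : 0 ≤ θ := le_max_right _ _
  have hvθ : θ + ∑ i ∈ S, v i = 1 := by
    rw [hv, ← Finset.sum_div, ← hU, hθ, hV]
    rcases le_total U 1 with h | h
    · rw [max_eq_left (by linarith), max_eq_right h]
      ring
    · rw [max_eq_right (by linarith), max_eq_left h, div_self (by linarith), zero_add]
  have hNr : (0 : ℝ) < N := by exact_mod_cast hN
  set z : ι → ℕ → ℝ := fun i j => c i j ^ (p i).toReal with hz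
  have hz0 : ∀ i ∈ S, ∀ j, 0 ≤ z i j := fun i hi j => Real.rpow_nonneg (hc0 i hi j) _
  have hcz : ∀ i ∈ S, ∀ j < N, c i j ≤ z i j ^ v i := by
    intro i hi j hj
    rw [hz, ← Real.rpow_mul (hc0 i hi j)]
    have h1 : (p i).toReal * v i ≤ 1 := by
      have : (p i).toReal * u i ≤ 1 := by
        rw [hu]
        simp only [ENNReal.toReal_inv]
        exact mul_inv_le_one
      rw [hv]
      simp only
      rw [← mul_div_assoc, div_le_one hV0]
      exact this.trans hV1
    exact Real.self_le_rpow_of_le_one (hc0 i hi j) (hc1 i hi j hj) h1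
  have hAG : ∀ j < N, ∏ i ∈ S, c i j ≤ (N : ℝ) ^ θ * (θ * (N : ℝ)⁻¹ + ∑ i ∈ S, v i * z i j) := by
    intro j hj
    -- The additional index `none` carries the constant factor `1/N` with weight `θ`.
    have h := Real.geom_mean_le_arith_mean_weighted (Finset.insertNone S)
      (fun o => o.elim θ v) (fun o => o.elim (N : ℝ)⁻¹ fun i => z i j) ?_ ?_ ?_
    · rw [Finset.prod_insertNone, Finset.sum_insertNone] at h
      simp only [Option.elim] at h
      rw [Real.inv_rpow hNr.le] at h
      calc ∏ i ∈ S, c i j ≤ ∏ i ∈ S, z i j ^ v i :=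
            Finset.prod_le_prod (fun i hi => hc0 i hi j) fun i hi => hcz i hi j hj
        _ = (N : ℝ) ^ θ * (((N : ℝ) ^ θ)⁻¹ * ∏ i ∈ S, z i j ^ v i) := by
            rw [mul_inv_cancel_left₀ (Real.rpow_pos_of_pos hNr θ).ne']
        _ ≤ _ := mul_le_mul_of_nonneg_left h (by positivity)
    · intro o _
      cases o with
      | none => exact hθ0
      | some i => exact hv0 i
    · rw [Finset.sum_insertNone]
      exact hvθ
    · intro o ho
      cases o with
      | none => simp only [Option.elim]; positivity
      | some i => exact hz0 i (by simpa using ho) j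
  calc ∑ j ∈ Finset.range N, ∏ i ∈ S, c i j
      ≤ ∑ j ∈ Finset.range N, (N : ℝ) ^ θ * (θ * (N : ℝ)⁻¹ + ∑ i ∈ S, v i * z i j) :=
        Finset.sum_le_sum fun j hj => hAG j (Finset.mem_range.1 hj)
    _ = (N : ℝ) ^ θ * (θ + ∑ i ∈ S, v i * ∑ j ∈ Finset.range N, z i j) := by
        rw [← Finset.mul_sum, Finset.sum_add_distrib, Finset.sum_comm]
        simp_rw [Finset.mul_sum]
        rw [Finset.sum_const, Finset.card_range, nsmul_eq_mul]
        congr 2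
        field_simp
    _ ≤ (N : ℝ) ^ θ * (θ + ∑ i ∈ S, v i) := by
        gcongr with i hi
        by_cases hpi : p i = ∞
        · simp [hv, hu, hpi]
        · exact mul_le_of_le_one_right (hv0 i) (hsum i hi hpi)
    _ = (N : ℝ) ^ θ := by rw [hvθ, mul_one]

/-- Hölder's inequality for a product of finite sequences whose exponents need not be conjugate. -/
lemma sum_prod_le {ι : Type*} (S : Finset ι) {p : ι → ℝ≥0∞} (hp : ∀ i ∈ S, 1 ≤ p i)
    {N : ℕ} (hN : 0 < N) {a : ι → ℕ → ℝ} {b : ι → ℝ} (ha : ∀ i ∈ S, ∀ j, 0 ≤ a i j)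
    (hb : ∀ i ∈ S, 0 ≤ b i) (hab : ∀ i ∈ S, ∀ j < N, a i j ≤ b i)
    (hsum : ∀ i ∈ S, p i ≠ ∞ →
      ∑ j ∈ Finset.range N, a i j ^ (p i).toReal ≤ b i ^ (p i).toReal) :
    ∑ j ∈ Finset.range N, ∏ i ∈ S, a i j ≤
      (N : ℝ) ^ (1 - ∑ i ∈ S, (p i)⁻¹).toReal * ∏ i ∈ S, b i := by
  have h := sum_prod_le_of_le_one S hp hN (c := fun i j => a i j / b i)
    (fun i hi j => div_nonneg (ha i hi j) (hb i hi))
    (fun i hi j hj => div_le_one_of_le₀ (hab i hi j hj) (hb i hi)) ?_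
  · have e : ∀ j ∈ Finset.range N, ∏ i ∈ S, a i j = (∏ i ∈ S, a i j / b i) * ∏ i ∈ S, b i := by
      intro j hj
      rw [← Finset.prod_mul_distrib]
      refine Finset.prod_congr rfl fun i hi => ?_
      by_cases hbi : b i = 0
      · have h1 := hab i hi j (Finset.mem_range.1 hj)
        rw [hbi] at h1
        simp [hbi, le_antisymm h1 (ha i hi j)]
      · rw [div_mul_cancel₀ _ hbi]
    rw [Finset.sum_congr rfl e, ← Finset.sum_mul]
    exact mul_le_mul_of_nonneg_right h (Finset.prod_nonneg hb)
  · intro i hi hpi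
    simp_rw [Real.div_rpow (ha i hi _) (hb i hi)]
    rw [← Finset.sum_div]
    exact div_le_one_of_le₀ (hsum i hi hpi) (Real.rpow_nonneg (hb i hi) _)

end Hoelder

/-! ### Hadamard matrices and extremal coupling matrices. -/

section Matrices

variable {𝕜 : Type*} [RCLike 𝕜]

/-- Sylvester's construction of Hadamard matrices. -/
lemma exists_hadamard (𝕜 : Type*) [RCLike 𝕜] (a : ℕ) : ∃ H : ℕ → ℕ → 𝕜,
    (∀ j l, ‖H j l‖ = 1) ∧ ∀ z : ℕ → 𝕜,
      ∑ j ∈ Finset.range (2 ^ a), ‖∑ l ∈ Finset.range (2 ^ a), H j l * z l‖ ^ 2 =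
        2 ^ a * ∑ l ∈ Finset.range (2 ^ a), ‖z l‖ ^ 2 := by
  induction a with
  | zero => exact ⟨fun _ _ => 1, by simp, by simp⟩
  | succ a ih =>
    obtain ⟨H, hH, hsum⟩ := ih
    set N := 2 ^ a with hN
    refine ⟨fun j l => (if N ≤ j ∧ N ≤ l then -1 else 1) * H (j % N) (l % N),
      fun j l => ?_, fun z => ?_⟩
    · rw [norm_mul, hH]
      split_ifs <;> simp
    · have hN2 : 2 ^ (a + 1) = N + N := by rw [pow_succ, ← hN]; ring
      rw [hN2]
      simp only [Finset.sum_range_add]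
      rw [← Finset.sum_add_distrib]
      -- Rows `j` and `N + j` are the sum and the difference of the transforms of the two halves of
      -- `z`, so the parallelogram law applies.
      have e : ∀ j ∈ Finset.range N,
          ‖∑ l ∈ Finset.range N, (if N ≤ j ∧ N ≤ l then -1 else 1) * H (j % N) (l % N) * z l +
            ∑ l ∈ Finset.range N, (if N ≤ j ∧ N ≤ N + l then -1 else 1) *
              H (j % N) ((N + l) % N) * z (N + l)‖ ^ 2 +
          ‖∑ l ∈ Finset.range N, (if N ≤ N + j ∧ N ≤ l then -1 else 1) *
              H ((N + j) % N) (l % N) * z l +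
            ∑ l ∈ Finset.range N, (if N ≤ N + j ∧ N ≤ N + l then -1 else 1) *
              H ((N + j) % N) ((N + l) % N) * z (N + l)‖ ^ 2 =
          2 * (‖∑ l ∈ Finset.range N, H j l * z (N + l)‖ ^ 2 +
            ‖∑ l ∈ Finset.range N, H j l * z l‖ ^ 2) := by
        intro j hj
        rw [← norm_add_sq_add_norm_sub_sq, ← Finset.sum_neg_distrib]
        rw [add_comm (∑ l ∈ Finset.range N, H j l * z (N + l))]
        rw [add_comm (∑ l ∈ Finset.range N, -(H j l * z (N + l)))]
        rw [Finset.mem_range] at hj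
        congr 4 <;> refine Finset.sum_congr rfl fun l hl => ?_ <;> rw [Finset.mem_range] at hl <;>
          simp [Nat.mod_eq_of_lt hj, Nat.mod_eq_of_lt hl, hj.not_ge, hl.not_ge]
      rw [Finset.sum_congr rfl e, ← Finset.mul_sum, Finset.sum_add_distrib, hsum, hsum, pow_succ]
      ring

lemma seqSpace.norm_apply_le {p : ℝ≥0∞} [Fact (1 ≤ p)] (x : seqSpace 𝕜 p) (j : ℕ) :
    ‖(x : lp (fun _ : ℕ => 𝕜) p) j‖ ≤ ‖x‖ :=
  lp.norm_apply_le_norm (zero_lt_one.trans_le Fact.out : 0 < p).ne' _ j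

lemma seqSpace.sum_rpow_le {p : ℝ≥0∞} [Fact (1 ≤ p)] (hp : p ≠ ∞) (x : seqSpace 𝕜 p) (N : ℕ) :
    ∑ j ∈ Finset.range N, ‖(x : lp (fun _ : ℕ => 𝕜) p) j‖ ^ p.toReal ≤ ‖x‖ ^ p.toReal :=
  lp.sum_rpow_le_norm_rpow
    (ENNReal.toReal_pos (zero_lt_one.trans_le Fact.out : 0 < p).ne' hp) _ _

/-- Matrices of size `N = 2 ^ a` whose rows all have norm at least `L` in `ℓ_{r^*}` and which have
norm at most `L` as operators from `X_r` to `ℓ_{min {r, 2}}`. -/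
lemma exists_matrix (𝕜 : Type*) [RCLike 𝕜] (r : ℝ≥0∞) [Fact (1 ≤ r)] (a : ℕ) :
    ∃ (u : ℕ → ℕ → 𝕜) (L : ℝ), 0 < L ∧
      (∀ x : seqSpace 𝕜 r, ∑ j ∈ Finset.range (2 ^ a),
        ‖∑ l ∈ Finset.range (2 ^ a), u j l * (x : lp (fun _ : ℕ => 𝕜) r) l‖ ^ (min r 2).toReal ≤
          (L * ‖x‖) ^ (min r 2).toReal) ∧
      ∀ j < 2 ^ a, ENNReal.ofReal L ≤
        lqNorm r.conjExponent fun l => if l < 2 ^ a then ‖u j l‖ₑ else 0 := by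
  have hr1 : 1 ≤ r := Fact.out
  have hr0 : r ≠ 0 := (zero_lt_one.trans_le hr1).ne'
  rcases le_total r 2 with h | h
  · refine ⟨fun j l => if j = l then 1 else 0, 1, one_pos, fun x => ?_, fun j hj => ?_⟩
    · rw [min_eq_left h, one_mul]
      refine le_trans (le_of_eq ?_)
        (seqSpace.sum_rpow_le (ne_top_of_le_ne_top (by simp) h) x (2 ^ a))
      refine Finset.sum_congr rfl fun j hj => ?_
      simp only [ite_mul, one_mul, zero_mul, Finset.sum_ite_eq, hj, if_true]
    · refine le_trans ?_ (le_lqNorm (by simp [ENNReal.conjExponent]) _ j)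
      simp [hj]
  · obtain ⟨H, hH, hsum⟩ := exists_hadamard 𝕜 a
    set t := (r⁻¹).toReal with ht
    have hN0 : 0 < 2 ^ a := by positivity
    have hNr : (0 : ℝ) < ((2 ^ a : ℕ) : ℝ) := by exact_mod_cast hN0
    have hrinv : r⁻¹ ≤ 2⁻¹ := ENNReal.inv_le_inv.2 h
    have hrt : r⁻¹ ≠ ∞ := ENNReal.inv_ne_top.2 hr0
    have ht2 : t ≤ 1 / 2 := by
      have := ENNReal.toReal_mono (by simp) hrinv
      simpa [ht] using this
    -- `L = N ^ (1 - 1/r)` is the `ℓ_{r^*}` norm of a unimodular row. It is also `N ^ (1/2) * N ^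
    -- (1/2 - 1/r)`: the Hadamard identity on `ℓ_2` combined with the norm of the inclusion of `ℓ_r`
    -- into `ℓ_2` in dimension `N`.
    refine ⟨H, ((2 ^ a : ℕ) : ℝ) ^ (1 - t), by positivity, fun x => ?_, fun j hj => ?_⟩
    · rw [min_eq_right h]
      simp only [ENNReal.toReal_ofNat, Real.rpow_ofNat]
      rw [hsum]
      -- Hölder's inequality for two copies of the same sequence: `∑ |x_j|² ≤ N ^ (1 - 2/r) ‖x‖²`.
      have h2 := sum_prod_le (Finset.univ : Finset (Fin 2)) (p := fun _ => r) (fun _ _ => hr1) hN0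
        (a := fun _ j => ‖(x : lp (fun _ : ℕ => 𝕜) r) j‖) (b := fun _ => ‖x‖)
        (fun _ _ _ => norm_nonneg _) (fun _ _ => norm_nonneg _)
        (fun _ _ j _ => seqSpace.norm_apply_le x j)
        (fun _ _ hrt => seqSpace.sum_rpow_le hrt x _)
      rw [toReal_one_sub_sum _ fun _ _ => hrt] at h2
      simp only [Finset.prod_const, Finset.card_univ, Fintype.card_fin, Finset.sum_const,
        nsmul_eq_mul, ← ht] at h2
      rw [max_eq_left (by push_cast; linarith)] at h2
      refine (mul_le_mul_of_nonneg_left h2 (by positivity)).trans_eq ?_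
      rw [mul_pow, ← mul_assoc, ← Real.rpow_natCast (_ ^ (1 - t)), ← Real.rpow_mul hNr.le]
      congr 1
      have : (2 : ℝ) ^ a = ((2 ^ a : ℕ) : ℝ) ^ (1 : ℝ) := by rw [Real.rpow_one]; push_cast; rfl
      rw [this, ← Real.rpow_add hNr]
      congr 1
      push_cast
      ring
    · have hc : r.conjExponent = (1 - r⁻¹)⁻¹ := conjExponent_eq_inv_one_sub_inv hr1
      have hlt : r⁻¹ < 1 := hrinv.trans_lt (by simp)
      have hct : r.conjExponent ≠ ∞ := by
        rw [hc]
        exact ENNReal.inv_ne_top.2 (tsub_pos_of_lt hlt).ne'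
      have hcr : 1 / r.conjExponent.toReal = 1 - t := by
        rw [hc, ENNReal.toReal_inv, one_div, inv_inv, ENNReal.toReal_sub_of_le hlt.le (by simp),
          ENNReal.toReal_one]
      have hc0 : 0 < r.conjExponent.toReal :=
        ENNReal.toReal_pos (by simp [ENNReal.conjExponent]) hct
      rw [lqNorm_of_ne_top hct, hcr, ← ENNReal.ofReal_rpow_of_nonneg hNr.le (by linarith),
        ENNReal.ofReal_natCast]
      gcongr
      · linarith
      refine le_trans (le_of_eq ?_) (ENNReal.sum_le_tsum (Finset.range (2 ^ a)))
      rw [Finset.sum_congr rfl (g := fun _ => 1)]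
      · simp
      · intro l hl
        rw [if_pos (Finset.mem_range.1 hl), ← ofReal_norm, hH]
        simp

end Matrices

/-! ### Lower bounds for mixed norms by restricting the indices. -/

section LowerBounds

lemma lqNorm_le_mixedNorm_diag {n : ℕ} {s : Fin (n + 1) → ℝ≥0∞} (hs : ∀ i, s i ≠ 0)
    (f : (Fin (n + 1) → ℕ) → ℝ≥0∞) (j : ℕ) :
    lqNorm (s (Fin.last n)) (fun l => f (Fin.snoc (α := fun _ => ℕ) (fun _ => j) l)) ≤
      mixedNorm (n + 1) s f := by
  induction n with
  | zero =>
    rw [mixedNorm_succ]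
    refine lqNorm_mono fun l => le_of_eq ?_
    simp only [mixedNorm]
    congr 1
    funext i
    refine Fin.cases ?_ (fun i => i.elim0) i
    rfl
  | succ n ih =>
    rw [mixedNorm_succ]
    refine le_trans (le_trans (le_of_eq ?_) (ih (s := fun i => s i.succ) (fun i => hs _)
      fun js => f (Fin.cons j js))) (le_lqNorm (hs 0) _ j)
    rw [Fin.succ_last]
    congr 1
    funext l
    rw [Fin.cons_snoc_eq_snoc_cons]
    congr 2
    funext i
    refine Fin.cases ?_ (fun i => ?_) i <;> rfl

/-- The multi-index `(0, …, 0, j, …, j, l)`, with `j` in the positions from `k` on. -/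
def testIndex {n : ℕ} (k : Fin n) (j l : ℕ) : Fin (n + 1) → ℕ :=
  Fin.snoc (α := fun _ => ℕ) (fun i => if i < k then 0 else j) l

/-- Each `ℓ_s` norm dominates any single term: index `0` is kept in the layers before `k`, and the
index `j` of layer `k` is repeated in the layers strictly between `k` and the last. -/
lemma lqNorm_le_mixedNorm_testIndex {n : ℕ} (k : Fin n) {s : Fin (n + 1) → ℝ≥0∞}
    (hs : ∀ i, s i ≠ 0) (f : (Fin (n + 1) → ℕ) → ℝ≥0∞) :
    lqNorm (s k.castSucc) (fun j => lqNorm (s (Fin.last n)) fun l => f (testIndex k j l)) ≤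
      mixedNorm (n + 1) s f := by
  induction n with
  | zero => exact k.elim0
  | succ n ih =>
    rw [mixedNorm_succ]
    refine Fin.cases ?_ (fun k => ?_) k
    · refine lqNorm_mono fun j => le_trans (le_of_eq ?_) (lqNorm_le_mixedNorm_diag
        (s := fun i => s i.succ) (fun i => hs _) (fun js => f (Fin.cons j js)) j)
      rw [Fin.succ_last]
      congr 1
      funext l
      rw [Fin.cons_snoc_eq_snoc_cons, testIndex]
      congr 2
      funext i
      refine Fin.cases ?_ (fun i => ?_) i <;> simp
    · refine le_trans (le_trans (le_of_eq ?_) (ih k (s := fun i => s i.succ) (fun i => hs _)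
        fun js => f (Fin.cons 0 js))) (le_lqNorm (hs 0) _ 0)
      rw [Fin.succ_last, ← Fin.succ_castSucc]
      congr 1
      funext j
      congr 1
      funext l
      rw [testIndex, testIndex, Fin.cons_snoc_eq_snoc_cons]
      congr 2
      funext i
      refine Fin.cases ?_ (fun i => ?_) i <;> simp

end LowerBounds

/-! ### The test form: its coefficients and norm. -/

section TestForm

variable {𝕜 : Type*} [RCLike 𝕜]

/-- The `j`-th coordinate functional on `X_p`. -/
noncomputable def seqSpace.coord (𝕜 : Type*) [RCLike 𝕜] (p : ℝ≥0∞) [Fact (1 ≤ p)] (j : ℕ) :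
    seqSpace 𝕜 p →L[𝕜] 𝕜 :=
  LinearMap.mkContinuous
    { toFun := fun x => (x : lp (fun _ : ℕ => 𝕜) p) j
      map_add' := fun _ _ => rfl
      map_smul' := fun _ _ => rfl } 1
    fun x => (seqSpace.norm_apply_le x j).trans_eq (one_mul _).symm

lemma seqSpace.coord_apply {p : ℝ≥0∞} [Fact (1 ≤ p)] (j : ℕ) (x : seqSpace 𝕜 p) :
    seqSpace.coord 𝕜 p j x = (x : lp (fun _ : ℕ => 𝕜) p) j := rfl

lemma seqSpace.coord_e {p : ℝ≥0∞} [Fact (1 ≤ p)] (i j : ℕ) :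
    seqSpace.coord 𝕜 p i (seqSpace.e 𝕜 p j) = if i = j then 1 else 0 := by
  rw [seqSpace.coord_apply, seqSpace.e, lp.coeFn_single, Pi.single_apply]

variable {n : ℕ} (p : Fin (n + 1) → ℝ≥0∞) [∀ i, Fact (1 ≤ p i)] (σ : Equiv.Perm (Fin (n + 1)))
  (k : Fin n) (N : ℕ) (u : ℕ → ℕ → 𝕜)

/-- The form `∑_{j,l<N} u_{jl} ∏_{i<k} x_i(0) ∏_{k≤i<n} x_i(j) x_n(l)`, the variables being listed
in the order given by `σ`. -/
noncomputable def testForm : ContinuousMultilinearMap 𝕜 (fun i => seqSpace 𝕜 (p i)) 𝕜 :=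
  ∑ j ∈ Finset.range N, ∑ l ∈ Finset.range N, u j l •
    (ContinuousMultilinearMap.mkPiAlgebra 𝕜 (Fin (n + 1)) 𝕜).compContinuousLinearMap
      fun i => seqSpace.coord 𝕜 (p i) (testIndex k j l (σ.symm i))

lemma testForm_apply (x : ∀ i, seqSpace 𝕜 (p i)) :
    testForm p σ k N u x = ∑ j ∈ Finset.range N, ∑ l ∈ Finset.range N,
      u j l * ∏ i, seqSpace.coord 𝕜 (p (σ i)) (testIndex k j l i) (x (σ i)) := by
  simp only [testForm, sum_apply, smul_apply,
    ContinuousMultilinearMap.compContinuousLinearMap_apply,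
    ContinuousMultilinearMap.mkPiAlgebra_apply, smul_eq_mul]
  refine Finset.sum_congr rfl fun j _ => Finset.sum_congr rfl fun l _ => ?_
  congr 1
  rw [← Equiv.prod_comp σ]
  simp

lemma testForm_apply_e {j l : ℕ} (hj : j < N) (hl : l < N) :
    (testForm p σ k N u fun i => seqSpace.e 𝕜 (p i) (testIndex k j l (σ.symm i))) = u j l := by
  rw [testForm_apply, Finset.sum_eq_single j, Finset.sum_eq_single l]
  · simp [seqSpace.coord_e]
  · intro l' _ hne
    rw [Finset.prod_eq_zero (i := Fin.last n) (Finset.mem_univ _), mul_zero]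
    simp [seqSpace.coord_e, testIndex, hne]
  · intro h
    exact absurd (Finset.mem_range.2 hl) h
  · intro j' _ hne
    refine Finset.sum_eq_zero fun l' _ => ?_
    rw [Finset.prod_eq_zero (i := k.castSucc) (Finset.mem_univ _), mul_zero]
    simp [seqSpace.coord_e, testIndex, hne]
  · intro h
    exact absurd (Finset.mem_range.2 hj) h

/-- Summing over `l` first replaces the last variable by its image `y` under the matrix, which lies
in `ℓ_{min(r,2)}` with norm at most `L ‖x‖`. Hölder's inequality over the factors from `k` on then
yields the truncated exponents; the factors before `k` are constant in `j`. -/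
lemma norm_testForm_le (hN : 0 < N) {L : ℝ} (hL : 0 < L)
    (hu : ∀ x : seqSpace 𝕜 (p (σ (Fin.last n))), ∑ j ∈ Finset.range N,
      ‖∑ l ∈ Finset.range N, u j l * (x : lp (fun _ : ℕ => 𝕜) (p (σ (Fin.last n)))) l‖ ^
        (min (p (σ (Fin.last n))) 2).toReal ≤ (L * ‖x‖) ^ (min (p (σ (Fin.last n))) 2).toReal) :
    ‖testForm p σ k N u‖ ≤
      L * (N : ℝ) ^ (1 - ∑ i ∈ Finset.Ici k.castSucc, (truncExp (fun i => p (σ i)) i)⁻¹).toReal := by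
  refine ContinuousMultilinearMap.opNorm_le_bound (by positivity) fun x => ?_
  set θ := (1 - ∑ i ∈ Finset.Ici k.castSucc, (truncExp (fun i => p (σ i)) i)⁻¹).toReal
  set ν := min (p (σ (Fin.last n))) 2 with hν
  have hν1 : 1 ≤ ν := le_min Fact.out (by norm_num)
  have hνt : ν ≠ ∞ := ne_top_of_le_ne_top (by simp) (min_le_right _ _)
  have hν0 : 0 < ν.toReal := ENNReal.toReal_pos (zero_lt_one.trans_le hν1).ne' hνt
  set y : ℕ → 𝕜 := fun j => ∑ l ∈ Finset.range N,
    u j l * (x (σ (Fin.last n)) : lp (fun _ : ℕ => 𝕜) (p (σ (Fin.last n)))) l with hy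
  set a : Fin (n + 1) → ℕ → ℝ := fun i j => Fin.snoc (α := fun _ => ℝ)
    (fun i : Fin n =>
      ‖(x (σ i.castSucc) : lp (fun _ : ℕ => 𝕜) (p (σ i.castSucc)))
        (if i < k then 0 else j)‖) ‖y j‖ i with ha
  set b : Fin (n + 1) → ℝ := Fin.snoc (α := fun _ => ℝ)
    (fun i : Fin n => ‖x (σ i.castSucc)‖) (L * ‖x (σ (Fin.last n))‖) with hb
  have ha0 : ∀ i j, 0 ≤ a i j := by
    intro i j
    refine Fin.lastCases ?_ (fun i => ?_) i <;> simp [ha]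
  have hb0 : ∀ i, 0 ≤ b i := by
    intro i
    refine Fin.lastCases ?_ (fun i => ?_) i
    · simp only [hb, Fin.snoc_last]; positivity
    · simp [hb]
  have hylast := hu (x (σ (Fin.last n)))
  have hab : ∀ i, ∀ j < N, a i j ≤ b i := by
    intro i j hj
    refine Fin.lastCases ?_ (fun i => ?_) i
    · simp only [ha, hb, Fin.snoc_last]
      rw [← Real.rpow_le_rpow_iff (norm_nonneg _) (by positivity) hν0]
      refine le_trans ?_ hylast
      exact Finset.single_le_sum (f := fun j => ‖y j‖ ^ ν.toReal) (fun _ _ => by positivity)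
        (Finset.mem_range.2 hj)
    · simp only [ha, hb, Fin.snoc_castSucc]
      exact seqSpace.norm_apply_le _ _
  have hH := sum_prod_le (Finset.Ici k.castSucc) (p := truncExp fun i => p (σ i)) ?_ hN
    (a := a) (b := b) (fun i _ j => ha0 i j) (fun i _ => hb0 i) (fun i _ => hab i) ?_
  · have hsplit : ∀ f : Fin (n + 1) → ℝ, ∏ i, f i =
        (∏ i ∈ Finset.Ici k.castSucc, f i) * ∏ i ∈ (Finset.Ici k.castSucc)ᶜ, f i := fun f =>
      (Finset.prod_mul_prod_compl _ _).symm
    have hbprod : ∏ i, b i = L * ∏ i, ‖x i‖ := by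
      rw [← Equiv.prod_comp σ fun i => ‖x i‖, Fin.prod_univ_castSucc, Fin.prod_univ_castSucc]
      simp only [hb, Fin.snoc_castSucc, Fin.snoc_last]
      ring
    calc ‖testForm p σ k N u x‖ ≤ ∑ j ∈ Finset.range N, ∏ i, a i j := by
          rw [testForm_apply]
          refine norm_sum_le_of_le _ fun j _ => le_of_eq ?_
          rw [Fin.prod_univ_castSucc]
          simp only [ha, Fin.snoc_castSucc, Fin.snoc_last]
          rw [← norm_prod, ← norm_mul]
          congr 1
          rw [hy, Finset.mul_sum]
          refine Finset.sum_congr rfl fun l _ => ?_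
          rw [Fin.prod_univ_castSucc]
          simp only [testIndex, Fin.snoc_castSucc, Fin.snoc_last, seqSpace.coord_apply]
          ring
      _ ≤ ∑ j ∈ Finset.range N,
          (∏ i ∈ Finset.Ici k.castSucc, a i j) * ∏ i ∈ (Finset.Ici k.castSucc)ᶜ, b i := by
          refine Finset.sum_le_sum fun j hj => ?_
          rw [hsplit]
          refine mul_le_mul_of_nonneg_left ?_ (Finset.prod_nonneg fun i _ => ha0 i j)
          exact Finset.prod_le_prod (fun i _ => ha0 i j) fun i _ => hab i j (Finset.mem_range.1 hj)
      _ ≤ (N : ℝ) ^ θ * (∏ i ∈ Finset.Ici k.castSucc, b i) *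
          ∏ i ∈ (Finset.Ici k.castSucc)ᶜ, b i := by
          rw [← Finset.sum_mul]
          exact mul_le_mul_of_nonneg_right hH (Finset.prod_nonneg fun i _ => hb0 i)
      _ = L * (N : ℝ) ^ θ * ∏ i, ‖x i‖ := by
          rw [mul_assoc, ← hsplit, hbprod]
          ring
  · intro i _
    refine Fin.lastCases ?_ (fun i => ?_) i
    · simpa only [truncExp, Fin.snoc_last] using hν1
    · simp only [truncExp, Fin.snoc_castSucc]
      exact Fact.out
  · intro i
    refine Fin.lastCases ?_ (fun i => ?_) i
    · intro _ _
      simp only [truncExp, ha, hb, Fin.snoc_last]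
      exact hylast
    · intro hi
      have hik : ¬ i < k := by simpa using hi
      simp only [truncExp, ha, hb, Fin.snoc_castSucc, hik, if_false]
      exact fun ht => seqSpace.sum_rpow_le ht _ N

/-- On the test indices the coefficients are the entries of `u`, so each of the `N` rows contributes
at least `L`. -/
lemma le_mixedNorm_testForm {s : Fin (n + 1) → ℝ≥0∞} (hs : ∀ i, s i ≠ 0) {L : ℝ≥0∞}
    (hsk : s k.castSucc ≠ ∞)
    (hL : ∀ j < N, L ≤ lqNorm (s (Fin.last n)) fun l => if l < N then ‖u j l‖ₑ else 0) :
    (N : ℝ≥0∞) ^ (1 / (s k.castSucc).toReal) * L ≤ mixedNorm (n + 1) s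
      fun t => ‖testForm p σ k N u fun i => seqSpace.e 𝕜 (p i) (t (σ.symm i))‖ₑ := by
  refine le_trans ?_ (lqNorm_le_mixedNorm_testIndex k hs _)
  have h0 := ENNReal.toReal_pos (hs k.castSucc) hsk
  have hrow : ∀ j < N, L ≤ lqNorm (s (Fin.last n)) fun l => ‖testForm p σ k N u fun i =>
      seqSpace.e 𝕜 (p i) (testIndex k j l (σ.symm i))‖ₑ := by
    intro j hj
    refine (hL j hj).trans (lqNorm_mono fun l => ?_)
    split_ifs with hl
    · rw [testForm_apply_e p σ k N u hj hl]
    · exact zero_le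
  rw [lqNorm_of_ne_top hsk]
  calc (N : ℝ≥0∞) ^ (1 / (s k.castSucc).toReal) * L
      = (∑ _j ∈ Finset.range N, L ^ (s k.castSucc).toReal) ^ (1 / (s k.castSucc).toReal) := by
        rw [Finset.sum_const, Finset.card_range, nsmul_eq_mul,
          ENNReal.mul_rpow_of_nonneg _ _ (by positivity), ← ENNReal.rpow_mul,
          mul_one_div_cancel h0.ne', ENNReal.rpow_one]
    _ ≤ _ := by
        gcongr
        refine le_trans (Finset.sum_le_sum fun j hj => ?_)
          (ENNReal.sum_le_tsum (Finset.range N))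
        exact ENNReal.rpow_le_rpow (hrow j (Finset.mem_range.1 hj)) h0.le

end TestForm

/-! ### Necessity: comparing powers of `N = 2 ^ a`. -/

section Necessity

lemma le_of_forall_two_pow_rpow_le {C s θ : ℝ}
    (h : ∀ a : ℕ, ((2 ^ a : ℕ) : ℝ) ^ s ≤ C * ((2 ^ a : ℕ) : ℝ) ^ θ) : s ≤ θ := by
  by_contra! hlt
  have hx : 1 < (2 : ℝ) ^ (s - θ) := Real.one_lt_rpow (by norm_num) (sub_pos.2 hlt)
  obtain ⟨a, ha⟩ := pow_unbounded_of_one_lt C hx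
  refine ha.not_ge ?_
  have h1 := h a
  have hN : (0 : ℝ) < ((2 ^ a : ℕ) : ℝ) := by positivity
  have e : ((2 : ℝ) ^ (s - θ)) ^ a = ((2 ^ a : ℕ) : ℝ) ^ (s - θ) := by
    rw [← Real.rpow_natCast, ← Real.rpow_mul (by norm_num), mul_comm, Real.rpow_mul (by norm_num),
      Real.rpow_natCast]
    push_cast
    rfl
  rw [e, Real.rpow_sub hN, div_le_iff₀ (by positivity)]
  exact h1

variable {𝕜 : Type*} [RCLike 𝕜]

theorem delta_le_of_mixedNorm_le {n : ℕ} (p : Fin (n + 1) → ℝ≥0∞) [∀ i, Fact (1 ≤ p i)]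
    (σ : Equiv.Perm (Fin (n + 1))) (k : Fin n) {s : Fin (n + 1) → ℝ≥0∞} (hs : ∀ i, s i ≠ 0)
    (hlast : s (Fin.last n) = (p (σ (Fin.last n))).conjExponent) {C : ℝ} (hC : 0 ≤ C)
    (h : ∀ A : ContinuousMultilinearMap 𝕜 (fun i => seqSpace 𝕜 (p i)) 𝕜,
      mixedNorm (n + 1) s (fun t => ‖A fun i => seqSpace.e 𝕜 (p i) (t (σ.symm i))‖ₑ) ≤
        ENNReal.ofReal (C * ‖A‖)) :
    delta (truncExp fun i => p (σ i)) k.castSucc ≤ s k.castSucc := by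
  by_cases hsk : s k.castSucc = ∞
  · rw [hsk]; exact le_top
  have h0 := ENNReal.toReal_pos (hs k.castSucc) hsk
  set Θ := 1 - ∑ i ∈ Finset.Ici k.castSucc, (truncExp (fun i => p (σ i)) i)⁻¹ with hΘ
  -- The factor `L` occurs on both sides and cancels, leaving `N ^ (1/s_k) ≤ C N ^ Θ` for all `N = 2
  -- ^ a`.
  have hkey : 1 / (s k.castSucc).toReal ≤ Θ.toReal := by
    refine le_of_forall_two_pow_rpow_le (C := C) fun a => ?_
    obtain ⟨u, L, hL, hu, hrow⟩ := exists_matrix 𝕜 (p (σ (Fin.last n))) a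
    rw [← hlast] at hrow
    have hN : 0 < 2 ^ a := by positivity
    have h1 := (le_mixedNorm_testForm p σ k (2 ^ a) u hs hsk hrow).trans (h _)
    have h2 := norm_testForm_le p σ k (2 ^ a) u hN hL hu
    have h3 := h1.trans (ENNReal.ofReal_le_ofReal (mul_le_mul_of_nonneg_left h2 hC))
    rw [← ENNReal.ofReal_natCast, ENNReal.ofReal_rpow_of_nonneg (by positivity) (by positivity),
      ← ENNReal.ofReal_mul (by positivity), ENNReal.ofReal_le_ofReal_iff (by positivity)] at h3
    refine le_of_mul_le_mul_right (h3.trans_eq ?_) hL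
    ring
  unfold delta
  rw [← hΘ, ENNReal.inv_le_iff_inv_le,
    ← ENNReal.toReal_le_toReal (ENNReal.inv_ne_top.2 (hs _))
      (ne_top_of_le_ne_top ENNReal.one_ne_top tsub_le_self), ENNReal.toReal_inv, ← one_div]
  exact hkey

end Necessity

/-! ### Reduction to the identity permutation and conclusion. -/

section Reindexing

variable {𝕜 : Type*} [RCLike 𝕜]

/-- Used for sufficiency only; the test form of the necessity part incorporates `σ` directly. -/
lemma exists_reindex {n : ℕ} (p : Fin (n + 1) → ℝ≥0∞) [∀ i, Fact (1 ≤ p i)]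
    (σ : Equiv.Perm (Fin (n + 1)))
    (A : ContinuousMultilinearMap 𝕜 (fun i => seqSpace 𝕜 (p i)) 𝕜) :
    ∃ B : ContinuousMultilinearMap 𝕜 (fun i => seqSpace 𝕜 (p (σ i))) 𝕜, ‖B‖ ≤ ‖A‖ ∧
      ∀ t : Fin (n + 1) → ℕ, (A fun i => seqSpace.e 𝕜 (p i) (t (σ.symm i))) =
        B fun i => seqSpace.e 𝕜 (p (σ i)) (t i) := by
  let φ : (∀ i, seqSpace 𝕜 (p (σ i))) ≃ ∀ i, seqSpace 𝕜 (p i) :=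
    Equiv.piCongrLeft (fun i => seqSpace 𝕜 (p i)) σ
  have hφ : ∀ y i, φ y (σ i) = y i := fun y i =>
    Equiv.piCongrLeft_apply_apply (fun i => seqSpace 𝕜 (p i)) σ y i
  have hφu : ∀ (y : ∀ i, seqSpace 𝕜 (p (σ i))) (l : Fin (n + 1)) (z : seqSpace 𝕜 (p (σ l))),
      φ (Function.update y l z) = Function.update (φ y) (σ l) z := by
    intro y l z
    funext i
    obtain ⟨i, rfl⟩ := σ.surjective i
    rw [hφ]
    by_cases hi : i = l
    · subst hi; simp
    · rw [Function.update_of_ne hi, Function.update_of_ne (σ.injective.ne hi), hφ]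
  let B' : MultilinearMap 𝕜 (fun i => seqSpace 𝕜 (p (σ i))) 𝕜 :=
    { toFun := fun y => A (φ y)
      map_update_add' := fun {inst} y l z w => by
        obtain rfl : inst = instDecidableEqFin _ := Subsingleton.elim _ _
        simp only [hφu, A.map_update_add]
      map_update_smul' := fun {inst} y l c z => by
        obtain rfl : inst = instDecidableEqFin _ := Subsingleton.elim _ _
        simp only [hφu, A.map_update_smul] }
  have hbound : ∀ y, ‖B' y‖ ≤ ‖A‖ * ∏ i, ‖y i‖ := by
    intro y
    refine (A.le_opNorm (φ y)).trans_eq ?_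
    rw [← Equiv.prod_comp σ]
    simp only [hφ]
  refine ⟨B'.mkContinuous ‖A‖ hbound, B'.mkContinuous_norm_le (norm_nonneg _) hbound,
    fun t => ?_⟩
  change A _ = A (φ _)
  congr 1
  funext i
  obtain ⟨i, rfl⟩ := σ.surjective i
  rw [hφ, Equiv.symm_apply_apply]

end Reindexing

/-- The number of variables is `m = n + 1 ≥ 2`. The multi-index `t` lists the summation indices in
the order of summation, `t l = j_{σ(l)}`, so that the `i`-th argument of `A` is
`e_{j_i} = e_{t (σ⁻¹ i)}`. -/
theorem theorem1 {𝕜 : Type*} [RCLike 𝕜] (n : ℕ) (hn : 1 ≤ n)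
    (σ : Equiv.Perm (Fin (n + 1)))
    (p : Fin (n + 1) → ℝ≥0∞) [∀ i, Fact (1 ≤ p i)]
    (q : Fin n → ℝ≥0∞) (hq : ∀ k, 0 < q k) :
    (∃ C : ℝ, 1 ≤ C ∧
      ∀ A : ContinuousMultilinearMap 𝕜 (fun i => seqSpace 𝕜 (p i)) 𝕜,
        mixedNorm (n + 1)
          (Fin.snoc (α := fun _ => ℝ≥0∞) q (ENNReal.conjExponent (p (σ (Fin.last n)))))
          (fun t => ‖A fun i => seqSpace.e 𝕜 (p i) (t (σ.symm i))‖ₑ)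
        ≤ ENNReal.ofReal (C * ‖A‖)) ↔
    ∀ k : Fin n,
      delta (Fin.snoc (α := fun _ => ℝ≥0∞) (fun i : Fin n => p (σ i.castSucc))
        (min (p (σ (Fin.last n))) 2)) k.castSucc ≤ q k := by
  set s : Fin (n + 1) → ℝ≥0∞ :=
    Fin.snoc (α := fun _ => ℝ≥0∞) q (ENNReal.conjExponent (p (σ (Fin.last n)))) with hs
  have hs0 : ∀ i, s i ≠ 0 := by
    intro i
    refine Fin.lastCases ?_ (fun i => ?_) i
    · simp [hs, ENNReal.conjExponent]
    · simpa [hs] using (hq i).ne'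
  constructor
  · rintro ⟨C, hC, h⟩ k
    have := delta_le_of_mixedNorm_le p σ k hs0 (by simp [hs]) (zero_le_one.trans hC) h
    simp only [hs, Fin.snoc_castSucc] at this
    exact this
  · intro h
    obtain ⟨C, hC, hbound⟩ := exists_arrayNorm_coeffArray_le (𝕜 := 𝕜) fun i => p (σ i)
    refine ⟨max 1 C.toReal, le_max_left _ _, fun A => ?_⟩
    obtain ⟨B, hB, hAB⟩ := exists_reindex p σ A
    simp only [hAB]
    have hle : ∀ i, optExp (fun i => p (σ i)) i ≤ s i := by
      intro i
      refine Fin.lastCases ?_ (fun i => ?_) i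
      · simp [optExp, hs]
      · simp only [optExp, hs, Fin.snoc_castSucc]
        exact h i
    -- The hypothesis says that the given exponents dominate `optExp`, so the optimal estimate for
    -- `B` is enough.
    refine (mixedNorm_antitone (optExp_ne_zero _) hle _).trans ((hbound B).trans ?_)
    rw [ENNReal.ofReal_mul (by positivity), ← ofReal_norm, ← ENNReal.ofReal_toReal hC]
    gcongr
    · rw [ENNReal.toReal_ofReal ENNReal.toReal_nonneg]
      exact le_max_right _ _
    · exact hB
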